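/- **Setting.** For a pencil $A-\lambda B$ let $\mathrm{nrank}(A,B)=\max_{\zeta\in\mathbb C}\mathrm{rank}(A-\zeta B)$. A number $\mu\in\mathbb C$ is an eigenvalue if $\mathrm{rank}(A-\mu B)<\mathrm{nrank}(A,B)$, and $\infty$ is an eigenvalue if $\mathrm{rank}(B)<\mathrm{nrank}(A,B)$; right and left eigenvectors $x,y\ne 0$ at $\mu$ satisfy $(A-\mu B)x=0$, $y^*(A-\mu B)=0$ (for $\mu=\infty$: $Bx=0$, $y^*B=0$). A square pencil is regular if $\det(A-\lambda B)\not\equiv 0$, and singular otherwise. By the Kronecker canonical form, $A-\lambda B$ is strictly equivalent to $\mathrm{diag}(R(\lambda),S(\lambda))$, where the regular part is $R(\lambda)=\mathrm{diag}(J-\lambda I,\,I-\lambda N)$ with $J,N$ in Jordan form and $N$ nilpotent, and $S(\lambda)$ consists of blocks $L_j(\lambda)=[0\ I_j]-\lambda[I_j\ 0]$ and $L_j(\lambda)^\top$, $j\ge 0$. Eigenvalues are semisimple if all their Jordan blocks (in $J$ or $N$) have size one, and simple if moreover there is only one such block. A subset of $\mathbb C^{n,k}$ is generic if its complement lies in a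 proper real algebraic subset of $\mathbb R^{2nk}\cong\mathbb C^{n,k}$. Let $A-\lambda B$ be a complex $n\times n$ singular pencil of normal rank $n-k$ all of whose eigenvalues are semisimple, with regular part $R(\lambda)$. Let $D_A,D_B\in\mathbb C^{k,k}$ be diagonal with $D_A-\lambda D_B$ regular and with no eigenvalue in common with $A-\lambda B$. For $\tau\ne 0$ and $U,V\in\mathbb C^{n,k}$ call a square pencil $R_{\rm ran}(\lambda)$ a *random part* of the perturbed pencil $$\widetilde A-\lambda\widetilde B=A-\lambda B+\tau\,U(D_A-\lambda D_B)V^*$$ if the following hold: 1. $R_{\rm ran}$ is regular, and $\widetilde A-\lambda\widetilde B$ is strictly equivalent to $\mathrm{diag}\bigl(R(\lambda),\,D_A-\lambda D_B,\,R_{\rm ran}(\lambda)\bigr)$; 2. at each eigenvalue of $R$, all right and left eigenvectors $x,y$ of $\widetilde A-\lambda\widetilde B$ satisfy $V^*x=0$ and $U^*y=0$; 3. at each eigenvalue of $D_A-\lambda D_B$, all right and left eigenvectors $x,y$ of $\widetilde A-\lambda\widetilde B$ satisfy $V^*x\neq0$ and $U^*y\neq0$; 4. the eigenvalues of $R_{\rm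 ran}$ are simple and distinct from those of $R$ and of $D_A-\lambda D_B$, and at each of them all right and left eigenvectors $x,y$ of $\widetilde A-\lambda\widetilde B$ satisfy either $V^*x=0$ and $U^*y\ne0$, or $V^*x\ne0$ and $U^*y=0$. The eigenvalues of $R_{\rm ran}$ are then called the *random eigenvalues*, and those of $A-\lambda B$ the *true eigenvalues*. **Proposition.** (i) There is a generic set $\Omega_2\subseteq\mathbb C^{n,k}$ such that for each $U\in\Omega_2$ there is a generic set $\Omega_3\subseteq\mathbb C^{n,k}$ such that for each $V\in\Omega_3$ there is one pencil $R_{\rm ran}$ that is a random part of the perturbed pencil for every $\tau\neq0$. (ii) Let $U,V\in\mathbb C^{n,k}$ and $\tau\ne0$ be such that the perturbed pencil has a random part $R_{\rm ran}$. Let the columns of $U_\perp,V_\perp\in\mathbb C^{n,n-k}$ form bases of the orthogonal complements of the ranges of $U$ and $V$, and assume that the $(n-k)\times(n-k)$ pencil $U_\perp^*(A-\lambda B)V_\perp$ is regular. Then the eigenvalues of $U_\perp^*(A-\lambda B)V_\perp$ in $\mathbb C\cup\{\infty\}$ are precisely a) the random eigenvalues of the perturbed pencil, and b) the true eigenvalues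 of $A-\lambda B$. This also holds with multiplicities: the multiset of the $n-k$ eigenvalues of $U_\perp^*(A-\lambda B)V_\perp$, counted with algebraic multiplicity, is the sum of the multisets of eigenvalues of $R_{\rm ran}$ and of $R$. -/

import Mathlib

open Matrix

noncomputable section

/-- A complex matrix pencil `A - λ B`. -/
structure MatPencil (m n : Type) where
  A : Matrix m n ℂ
  B : Matrix m n ℂ

namespace MatPencil

variable {m n m' n' : Type}

/-- The value of the pencil at a point of `ℂ ∪ {∞}`: `A - z B` at `z : ℂ`, and `B` at `∞`. -/
def at' (P : MatPencil m n) : OnePoint ℂ → Matrix m n ℂ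
  | OnePoint.infty => P.B
  | OnePoint.some z => P.A - z • P.B

/-- The normal rank `max_{z ∈ ℂ} rank (A - z B)`. -/
def nrank [Fintype n] (P : MatPencil m n) : ℕ :=
  ⨆ z : ℂ, (P.A - z • P.B).rank

/-- `μ ∈ ℂ` is an eigenvalue iff `rank (A - μ B) < nrank`, and `∞` iff `rank B < nrank`. -/
def IsEigenvalue [Fintype n] (P : MatPencil m n) (μ : OnePoint ℂ) : Prop :=
  (P.at' μ).rank < P.nrank

/-- `x` is a right eigenvector at `μ`: `x ≠ 0` and `(A - μ B) x = 0` (resp. `B x = 0`). -/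
def IsRightEigenvector [Fintype n] (P : MatPencil m n) (μ : OnePoint ℂ) (x : n → ℂ) : Prop :=
  x ≠ 0 ∧ P.at' μ *ᵥ x = 0

/-- `y` is a left eigenvector at `μ`: `y ≠ 0` and `y* (A - μ B) = 0` (resp. `y* B = 0`). -/
def IsLeftEigenvector [Fintype m] (P : MatPencil m n) (μ : OnePoint ℂ) (y : m → ℂ) : Prop :=
  y ≠ 0 ∧ star y ᵥ* P.at' μ = 0

/-- A square pencil is regular if `det (A - λ B)` is not identically zero. -/
def IsRegular [Fintype n] [DecidableEq n] (P : MatPencil n n) : Prop :=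
  ∃ z : ℂ, (P.A - z • P.B).det ≠ 0

/-- The characteristic polynomial `det (A - X B)` of a square pencil. -/
def charpoly [Fintype n] [DecidableEq n] (P : MatPencil n n) : Polynomial ℂ :=
  (P.A.map Polynomial.C - (Polynomial.X : Polynomial ℂ) • P.B.map Polynomial.C).det

/-- The eigenvalues in `ℂ ∪ {∞}` of a square regular pencil, listed with algebraic
multiplicities: a finite one counts as often as it is a root of `det (A - X B)`, and `∞` counts
as often as the degree of that polynomial falls short of the size of the pencil. -/
def eigs [Fintype n] [DecidableEq n] (P : MatPencil n n) : Multiset (OnePoint ℂ) :=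
  P.charpoly.roots.map (fun z => OnePoint.some z) +
    Multiset.replicate (Fintype.card n - P.charpoly.natDegree) OnePoint.infty

/-- Block diagonal sum of two pencils. -/
def directSum (P : MatPencil m n) (P' : MatPencil m' n') : MatPencil (m ⊕ m') (n ⊕ n') where
  A := fromBlocks P.A 0 0 P'.A
  B := fromBlocks P.B 0 0 P'.B

/-- Strict equivalence: `S (A - λ B) T` equals the other pencil for some nonsingular `S`, `T`
(rows and columns of the other pencil being renumbered by bijections of the index types). -/
def StrictEquiv [Fintype m] [Fintype n] [DecidableEq m] [DecidableEq n]
    (P : MatPencil m n) (P' : MatPencil m' n') : Prop :=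
  ∃ (e : m ≃ m') (f : n ≃ n') (S : Matrix m m ℂ) (T : Matrix n n ℂ), IsUnit S ∧ IsUnit T ∧
    S * P.A * T = P'.A.submatrix e f ∧ S * P.B * T = P'.B.submatrix e f

/-- The two-sided projection `W* (A - λ B) Z`. -/
def compress {p q : Type} [Fintype m] [Fintype n] (P : MatPencil m n)
    (W : Matrix m p ℂ) (Z : Matrix n q ℂ) : MatPencil p q where
  A := Wᴴ * P.A * Z
  B := Wᴴ * P.B * Z

/-- The perturbed pencil `A - λ B + τ U (D_A - λ D_B) V*`. -/
def perturb {κ : Type} [Fintype κ] (P : MatPencil m n) (D : MatPencil κ κ)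
    (U : Matrix m κ ℂ) (V : Matrix n κ ℂ) (τ : ℂ) : MatPencil m n where
  A := P.A + τ • (U * D.A * Vᴴ)
  B := P.B + τ • (U * D.B * Vᴴ)

end MatPencil

/-- The Jordan block of size `d` with eigenvalue `z`. -/
def jordanBlock (d : ℕ) (z : ℂ) : Matrix (Fin d) (Fin d) ℂ :=
  Matrix.of fun i j => if i = j then z else if (i : ℕ) + 1 = j then 1 else 0

/-- The `d × (d + 1)` matrix `[0 I_d]`. -/
def blockZeroOne (d : ℕ) : Matrix (Fin d) (Fin (d + 1)) ℂ :=
  Matrix.of fun i j => if j = i.succ then 1 else 0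

/-- The `d × (d + 1)` matrix `[I_d 0]`. -/
def blockOneZero (d : ℕ) : Matrix (Fin d) (Fin (d + 1)) ℂ :=
  Matrix.of fun i j => if j = i.castSucc then 1 else 0

/-- The data of a Kronecker canonical form: the Jordan blocks for finite eigenvalues (eigenvalue
and size), the sizes of the Jordan blocks for `∞`, and the right and left minimal indices. -/
structure KroneckerData where
  numFin : ℕ
  finEig : Fin numFin → ℂ
  finSize : Fin numFin → ℕ
  finSize_pos : ∀ i, 0 < finSize i
  numInf : ℕ
  infSize : Fin numInf → ℕ
  infSize_pos : ∀ i, 0 < infSize i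
  numRight : ℕ
  rightIndex : Fin numRight → ℕ
  numLeft : ℕ
  leftIndex : Fin numLeft → ℕ

namespace KroneckerData

/-- Index type of the regular part. -/
abbrev RegIdx (K : KroneckerData) : Type :=
  (Σ i : Fin K.numFin, Fin (K.finSize i)) ⊕ (Σ i : Fin K.numInf, Fin (K.infSize i))

/-- Row index type of the singular part. -/
abbrev SingRow (K : KroneckerData) : Type :=
  (Σ i : Fin K.numRight, Fin (K.rightIndex i)) ⊕ (Σ i : Fin K.numLeft, Fin (K.leftIndex i + 1))

/-- Column index type of the singular part. -/
abbrev SingCol (K : KroneckerData) : Type :=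
  (Σ i : Fin K.numRight, Fin (K.rightIndex i + 1)) ⊕ (Σ i : Fin K.numLeft, Fin (K.leftIndex i))

/-- The regular part `diag (J - λ I, I - λ N)`. -/
def regularPart (K : KroneckerData) : MatPencil K.RegIdx K.RegIdx where
  A := fromBlocks (blockDiagonal' fun i => jordanBlock (K.finSize i) (K.finEig i)) 0 0 1
  B := fromBlocks 1 0 0 (blockDiagonal' fun i => jordanBlock (K.infSize i) 0)

/-- The singular part `diag (L_{m_1}, …, L_{m_p}, L_{n_1}ᵀ, …, L_{n_q}ᵀ)`, where
`L_d = [0 I_d] - λ [I_d 0]`. -/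
def singularPart (K : KroneckerData) : MatPencil K.SingRow K.SingCol where
  A := fromBlocks (blockDiagonal' fun i => blockZeroOne (K.rightIndex i)) 0 0
    (blockDiagonal' fun i => (blockZeroOne (K.leftIndex i))ᵀ)
  B := fromBlocks (blockDiagonal' fun i => blockOneZero (K.rightIndex i)) 0 0
    (blockDiagonal' fun i => (blockOneZero (K.leftIndex i))ᵀ)

/-- All eigenvalues are semisimple: every Jordan block has size one. -/
def Semisimple (K : KroneckerData) : Prop :=
  (∀ i, K.finSize i = 1) ∧ (∀ i, K.infSize i = 1)

/-- All eigenvalues are simple: every eigenvalue has just one Jordan block, of size one. -/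
def Simple (K : KroneckerData) : Prop :=
  K.Semisimple ∧ Function.Injective K.finEig ∧ K.numInf ≤ 1

end KroneckerData

namespace MatPencil

/-- `K` is a Kronecker canonical form of the pencil `P`. -/
def IsKCF {m n : Type} [Fintype m] [Fintype n] [DecidableEq m] [DecidableEq n]
    (P : MatPencil m n) (K : KroneckerData) : Prop :=
  P.StrictEquiv (K.regularPart.directSum K.singularPart)

end MatPencil

/-- A set of complex matrices is generic if its complement is contained in a proper real algebraic
subset, i.e. in the set of common zeros of finitely many real polynomials in the real and
imaginary parts of the entries, and this set of zeros is not everything. -/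
def IsGenericSet {m n : Type} (Ω : Set (Matrix m n ℂ)) : Prop :=
  ∃ F : Finset (MvPolynomial ((m × n) ⊕ (m × n)) ℝ),
    let Z : Set (Matrix m n ℂ) := {M | ∀ p ∈ F, MvPolynomial.eval
      (Sum.elim (fun ij => (M ij.1 ij.2).re) (fun ij => (M ij.1 ij.2).im)) p = 0}
    Z ≠ Set.univ ∧ Ωᶜ ⊆ Z

/-- The columns of `W` form a basis of the orthogonal complement of the range of `U`. -/
def IsOrthComplBasis {m κ p : Type} [Fintype m] [Fintype κ]
    (U : Matrix m κ ℂ) (W : Matrix m p ℂ) : Prop :=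
  LinearIndependent ℂ (fun j : p => fun i : m => W i j) ∧
    ∀ w : m → ℂ, w ∈ Submodule.span ℂ (Set.range (fun j : p => fun i : m => W i j)) ↔
      ∀ c : κ → ℂ, star (U *ᵥ c) ⬝ᵥ w = 0

/-- The perturbation of the pencil `P`, with regular part `R`, by `τ U (D_A - λ D_B) V*` splits
into a true part `R`, a prescribed part `D` and a random part `Ran`, with the characteristic
behaviour of the eigenvectors for each of them. -/
structure IsRankCompletion {n κ ρ σ : Type} [Fintype n] [DecidableEq n] [Fintype κ]
    [Fintype ρ] [Fintype σ] [DecidableEq σ]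
    (P : MatPencil n n) (R : MatPencil ρ ρ) (D : MatPencil κ κ) (U V : Matrix n κ ℂ) (τ : ℂ)
    (Ran : MatPencil σ σ) : Prop where
  strictEquiv : (P.perturb D U V τ).StrictEquiv (R.directSum (D.directSum Ran))
  regular : Ran.IsRegular
  true_right : ∀ μ, R.IsEigenvalue μ → ∀ x, (P.perturb D U V τ).IsRightEigenvector μ x →
    Vᴴ *ᵥ x = 0
  true_left : ∀ μ, R.IsEigenvalue μ → ∀ y, (P.perturb D U V τ).IsLeftEigenvector μ y →
    Uᴴ *ᵥ y = 0
  prescribed_right : ∀ μ, D.IsEigenvalue μ → ∀ x, (P.perturb D U V τ).IsRightEigenvector μ x →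
    Vᴴ *ᵥ x ≠ 0
  prescribed_left : ∀ μ, D.IsEigenvalue μ → ∀ y, (P.perturb D U V τ).IsLeftEigenvector μ y →
    Uᴴ *ᵥ y ≠ 0
  random_simple : ∃ K : KroneckerData, Ran.IsKCF K ∧ K.Simple
  random_distinct : ∀ μ, Ran.IsEigenvalue μ → ¬ R.IsEigenvalue μ ∧ ¬ D.IsEigenvalue μ
  random_vectors : ∀ μ, Ran.IsEigenvalue μ →
    ∀ x, (P.perturb D U V τ).IsRightEigenvector μ x →
    ∀ y, (P.perturb D U V τ).IsLeftEigenvector μ y →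
      (Vᴴ *ᵥ x = 0 ∧ Uᴴ *ᵥ y ≠ 0) ∨ (Vᴴ *ᵥ x ≠ 0 ∧ Uᴴ *ᵥ y = 0)

end

/-! Part (ii) is a Schur complement computation. In the bases `[U_⊥ U]` and `[V_⊥ V]` the
perturbation touches only the lower right `k × k` block. Wherever the leading block `U_⊥*(A -
λB)V_⊥` is invertible, `rank (A - λB) ≤ n - k` forces the unperturbed Schur complement to vanish. So
the perturbed determinant is a nonzero constant times the projected determinant times `det (D_A -
λD_B)` (`exists_charpoly_perturb_eq`). Strict equivalence expresses the same determinant through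
`R`, `D` and `Ran`, and `D` cancels. Roots give the finite eigenvalues, the degree defect gives `∞`
(`eigs_compress_eq`). No eigenvector condition enters.

For part (i), counting rows and columns gives exactly `k` blocks `L_{m_i}` and `k` transposed
blocks. If `T v(λ)` spans the kernel coming from the `L_{m_i}`, then `det (V* T v(λ))` is a
polynomial of degree at most `∑ m_i`. For generic `V` it has full degree and simple roots `α`
outside any given finite set, and away from the eigenvalues of `A - λB` these are the points where
the kernels of `A - λB` and `V*` meet (`exists_isGenericSet_isKernelRoots`). The transposed pencil
and `U` give points `β` in the same way. The random part is `diag (α - λ, β - λ)`, in which `τ` does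
not occur.

A common kernel vector of `A - λB` and `V*` survives the perturbation, and likewise on the left.
Hence at every point of `ℂ ∪ {∞}` the perturbed pencil has rank at most that of `diag (R, D, Ran)`.
The latter is diagonal because all eigenvalues are semisimple, and a regular pencil with such large
kernels is strictly equivalent to it (`IsRegular.strictEquiv_diag`). The eigenvector conditions then
follow by comparing kernel dimensions (`isRankCompletion_ofEigenvalues`). -/

noncomputable section

/-! ### Ranks, kernels and determinants of matrices -/

namespace Matrix

variable {m n m' n' κ : Type*}

theorem rank_add_finrank_ker [Fintype n] (M : Matrix m n ℂ) :
    M.rank + Module.finrank ℂ (LinearMap.ker M.mulVecLin) = Fintype.card n := by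
  rw [Matrix.rank, LinearMap.finrank_range_add_finrank_ker, Module.finrank_fintype_fun_eq_card]

theorem rank_le_of_ker_le [Fintype n] {M : Matrix m n ℂ} {N : Matrix m' n ℂ}
    (h : ∀ x, N *ᵥ x = 0 → M *ᵥ x = 0) : M.rank ≤ N.rank := by
  have h1 := rank_add_finrank_ker M
  have h2 := rank_add_finrank_ker N
  have h3 : LinearMap.ker N.mulVecLin ≤ LinearMap.ker M.mulVecLin := fun x hx => by
    simpa using h x (by simpa using hx)
  have := Submodule.finrank_mono h3
  omega

/-- Nested kernels of equal dimension coincide; this turns rank counts into statements about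
eigenvectors. -/
theorem ker_eq_of_rank_le [Fintype n] {M : Matrix m n ℂ} {N : Matrix m' n ℂ}
    (h : ∀ x, N *ᵥ x = 0 → M *ᵥ x = 0) (hr : N.rank ≤ M.rank) {x : n → ℂ}
    (hx : M *ᵥ x = 0) : N *ᵥ x = 0 := by
  have h1 := rank_add_finrank_ker M
  have h2 := rank_add_finrank_ker N
  have h3 : LinearMap.ker N.mulVecLin ≤ LinearMap.ker M.mulVecLin := fun x hx => by
    simpa using h x (by simpa using hx)
  have h4 := Submodule.eq_of_le_of_finrank_le h3 (by omega)
  have : x ∈ LinearMap.ker N.mulVecLin := by rw [h4]; simpa using hx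
  simpa using this

theorem rank_eq_card_of_injective [Fintype n] {M : Matrix m n ℂ}
    (h : ∀ x, M *ᵥ x = 0 → x = 0) : M.rank = Fintype.card n := by
  have h1 := rank_add_finrank_ker M
  have : LinearMap.ker M.mulVecLin = ⊥ := by
    rw [LinearMap.ker_eq_bot']
    intro x hx
    exact h x (by simpa using hx)
  rw [this, finrank_bot] at h1
  omega

theorem rank_fromBlocks_diag [Fintype n] [Fintype n']
    (A : Matrix m n ℂ) (B : Matrix m' n' ℂ) :
    (fromBlocks A 0 0 B).rank = A.rank + B.rank := by
  have h0 := rank_add_finrank_ker (fromBlocks A 0 0 B)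
  have h1 := rank_add_finrank_ker A
  have h2 := rank_add_finrank_ker B
  have e : LinearMap.ker (fromBlocks A 0 0 B).mulVecLin ≃ₗ[ℂ]
      (LinearMap.ker A.mulVecLin × LinearMap.ker B.mulVecLin) :=
    { toFun := fun x => (⟨x.1 ∘ Sum.inl, by
          have := x.2
          simp only [LinearMap.mem_ker, mulVecLin_apply, fromBlocks_mulVec] at this ⊢
          ext i
          simpa using congrFun this (Sum.inl i)⟩, ⟨x.1 ∘ Sum.inr, by
          have := x.2
          simp only [LinearMap.mem_ker, mulVecLin_apply, fromBlocks_mulVec] at this ⊢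
          ext i
          simpa using congrFun this (Sum.inr i)⟩)
      invFun := fun p => ⟨Sum.elim p.1.1 p.2.1, by
          have h1 := p.1.2
          have h2 := p.2.2
          simp only [LinearMap.mem_ker, mulVecLin_apply, fromBlocks_mulVec] at h1 h2 ⊢
          ext i
          rcases i with i | i
          · simpa using congrFun h1 i
          · simpa using congrFun h2 i⟩
      map_add' := fun _ _ => rfl
      map_smul' := fun _ _ => rfl
      left_inv := fun x => by
        ext i
        rcases i with i | i <;> rfl
      right_inv := fun p => rfl }
  rw [e.finrank_eq, Module.finrank_prod, Fintype.card_sum] at h0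
  omega

/-- The constant is a permutation sign. It must not depend on `M`, so that it becomes one factor of
a whole characteristic polynomial. -/
theorem exists_det_submatrix_equiv_eq [Fintype m] [DecidableEq m] [Fintype n] [DecidableEq n]
    (e f : m ≃ n) : ∃ c : ℂ, c ≠ 0 ∧ ∀ M : Matrix n n ℂ, (M.submatrix e f).det = c * M.det := by
  refine ⟨((Equiv.Perm.sign (f.symm.trans e) : ℤ) : ℂ), by
    rcases Int.units_eq_one_or (Equiv.Perm.sign (f.symm.trans e)) with h | h <;> simp [h], ?_⟩
  intro M
  have : M.submatrix e f = (M.submatrix (f.symm.trans e) id).submatrix f f := by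
    ext i j; simp
  rw [this, det_submatrix_equiv_self, det_permute]

theorem dotProduct_star_mulVec [Fintype n] [Fintype κ] (U : Matrix n κ ℂ) (c : κ → ℂ) (w : n → ℂ) :
    star (U *ᵥ c) ⬝ᵥ w = star c ⬝ᵥ (Uᴴ *ᵥ w) := by
  rw [star_mulVec, ← dotProduct_mulVec]

end Matrix

/-! ### Values of pencils on `ℂ ∪ {∞}`, strict equivalence -/

namespace MatPencil

variable {m n m' n' κ p q : Type}

/-- The coefficient of `A` in the value of a pencil at a point of `ℂ ∪ {∞}`. -/
def coeffA : OnePoint ℂ → ℂ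
  | OnePoint.infty => 0
  | OnePoint.some _ => 1

/-- The coefficient of `B` in the value of a pencil at a point of `ℂ ∪ {∞}`. -/
def coeffB : OnePoint ℂ → ℂ
  | OnePoint.infty => 1
  | OnePoint.some z => -z

/-- In homogeneous coordinates the value is linear in `(A, B)`, so identities need no case split
between finite points and `∞`. -/
theorem at'_eq (P : MatPencil m n) (μ : OnePoint ℂ) :
    P.at' μ = coeffA μ • P.A + coeffB μ • P.B := by
  rcases μ with _ | z
  · change P.B = (0 : ℂ) • P.A + (1 : ℂ) • P.B
    simp
  · change P.A - z • P.B = (1 : ℂ) • P.A + (-z) • P.B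
    rw [one_smul, neg_smul, sub_eq_add_neg]

theorem at'_coe (P : MatPencil m n) (z : ℂ) : P.at' (z : OnePoint ℂ) = P.A - z • P.B := rfl

theorem at'_infty (P : MatPencil m n) : P.at' OnePoint.infty = P.B := rfl

theorem at'_directSum (P : MatPencil m n) (P' : MatPencil m' n') (μ : OnePoint ℂ) :
    (P.directSum P').at' μ = fromBlocks (P.at' μ) 0 0 (P'.at' μ) := by
  simp only [at'_eq, directSum, fromBlocks_smul, fromBlocks_add, smul_zero, add_zero]

theorem at'_perturb [Fintype κ] (P : MatPencil m n) (D : MatPencil κ κ)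
    (U : Matrix m κ ℂ) (V : Matrix n κ ℂ) (τ : ℂ) (μ : OnePoint ℂ) :
    (P.perturb D U V τ).at' μ = P.at' μ + τ • (U * D.at' μ * Vᴴ) := by
  simp only [at'_eq, perturb, Matrix.mul_add, Matrix.add_mul, Matrix.mul_smul, Matrix.smul_mul,
    smul_add, smul_comm τ]
  abel

theorem at'_compress [Fintype m] [Fintype n] (P : MatPencil m n)
    (W : Matrix m p ℂ) (Z : Matrix n q ℂ) (μ : OnePoint ℂ) :
    (P.compress W Z).at' μ = Wᴴ * P.at' μ * Z := by
  simp only [at'_eq, compress, Matrix.mul_add, Matrix.add_mul, Matrix.mul_smul, Matrix.smul_mul]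

/-- The transposed pencil. -/
def transpose (P : MatPencil m n) : MatPencil n m where
  A := P.Aᵀ
  B := P.Bᵀ

theorem at'_transpose (P : MatPencil m n) (μ : OnePoint ℂ) :
    P.transpose.at' μ = (P.at' μ)ᵀ := by
  simp only [at'_eq, transpose, transpose_add, transpose_smul]

theorem StrictEquiv.at'_eq [Fintype m] [Fintype n] [DecidableEq m] [DecidableEq n]
    {P : MatPencil m n} {P' : MatPencil m' n'} (h : P.StrictEquiv P') :
    ∃ (e : m ≃ m') (f : n ≃ n') (S : Matrix m m ℂ) (T : Matrix n n ℂ), IsUnit S ∧ IsUnit T ∧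
      ∀ μ, S * P.at' μ * T = (P'.at' μ).submatrix e f := by
  obtain ⟨e, f, S, T, hS, hT, hA, hB⟩ := h
  refine ⟨e, f, S, T, hS, hT, fun μ => ?_⟩
  simp only [MatPencil.at'_eq, Matrix.mul_add, Matrix.add_mul, Matrix.mul_smul, Matrix.smul_mul,
    hA, hB, submatrix_add, submatrix_smul, Pi.add_apply, Pi.smul_apply]

theorem StrictEquiv.rank_eq [Fintype m] [Fintype n] [DecidableEq m] [DecidableEq n]
    [Fintype n']
    {P : MatPencil m n} {P' : MatPencil m' n'} (h : P.StrictEquiv P') (μ : OnePoint ℂ) :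
    (P.at' μ).rank = (P'.at' μ).rank := by
  obtain ⟨e, f, S, T, hS, hT, hST⟩ := h.at'_eq
  have : Fintype m' := Fintype.ofEquiv m e
  rw [← rank_submatrix (P'.at' μ) e f, ← hST μ,
    rank_mul_eq_left_of_isUnit_det _ _ ((isUnit_iff_isUnit_det T).1 hT),
    rank_mul_eq_right_of_isUnit_det _ _ ((isUnit_iff_isUnit_det S).1 hS)]

theorem rank_directSum [Fintype n] [Fintype n'] (P : MatPencil m n) (P' : MatPencil m' n')
    (μ : OnePoint ℂ) :
    ((P.directSum P').at' μ).rank = (P.at' μ).rank + (P'.at' μ).rank := by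
  rw [at'_directSum, rank_fromBlocks_diag]

theorem bddAbove_rank [Fintype n] (P : MatPencil m n) :
    BddAbove (Set.range fun z : ℂ => (P.A - z • P.B).rank) :=
  ⟨Fintype.card n, by rintro _ ⟨z, rfl⟩; exact rank_le_card_width _⟩

theorem rank_le_nrank [Fintype n] (P : MatPencil m n) (z : ℂ) :
    (P.at' (z : OnePoint ℂ)).rank ≤ P.nrank :=
  le_ciSup P.bddAbove_rank z

/-! ### Characteristic polynomials and eigenvalues of regular pencils -/

section Square

variable [Fintype n] [DecidableEq n]

theorem eval_charpoly (P : MatPencil n n) (z : ℂ) :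
    P.charpoly.eval z = (P.at' (z : OnePoint ℂ)).det := by
  rw [charpoly, ← Polynomial.coe_evalRingHom, RingHom.map_det, at'_coe]
  congr 1
  ext i j
  simp
  ring

theorem charpoly_eq (P : MatPencil n n) :
    P.charpoly = ((Polynomial.X : Polynomial ℂ) • (-P.B).map Polynomial.C +
      P.A.map Polynomial.C).det := by
  rw [charpoly]
  congr 1
  ext i j : 2
  simp
  ring

theorem natDegree_charpoly_le (P : MatPencil n n) : P.charpoly.natDegree ≤ Fintype.card n := by
  rw [charpoly_eq]
  exact Polynomial.natDegree_det_X_add_C_le _ _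

/-- This coefficient vanishes exactly when `B` is singular, which links the degree defect to the
eigenvalue `∞`. -/
theorem coeff_charpoly_card (P : MatPencil n n) :
    P.charpoly.coeff (Fintype.card n) = (-P.B).det := by
  rw [charpoly_eq, Polynomial.coeff_det_X_add_C_card]

theorem isRegular_iff (P : MatPencil n n) : P.IsRegular ↔ P.charpoly ≠ 0 := by
  constructor
  · rintro ⟨z, hz⟩ h
    apply hz
    rw [← at'_coe, ← eval_charpoly, h, Polynomial.eval_zero]
  · intro h
    by_contra hn
    apply h
    refine Polynomial.funext fun z => ?_
    rw [eval_charpoly, Polynomial.eval_zero, at'_coe]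
    by_contra hz
    exact hn ⟨z, hz⟩

theorem rank_lt_card_iff (M : Matrix n n ℂ) : M.rank < Fintype.card n ↔ M.det = 0 := by
  constructor
  · intro h
    by_contra hd
    rw [rank_of_det_ne_zero hd] at h
    exact lt_irrefl _ h
  · intro h
    refine lt_of_le_of_ne (rank_le_card_width _) fun he => ?_
    obtain ⟨v, hv, hv0⟩ := exists_mulVec_eq_zero_iff.2 h
    have h1 := rank_add_finrank_ker M
    have : v ∈ LinearMap.ker M.mulVecLin := by simpa using hv0
    have h2 : LinearMap.ker M.mulVecLin = ⊥ := Submodule.finrank_eq_zero.1 (by omega)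
    rw [h2] at this
    exact hv (by simpa using this)

theorem IsRegular.nrank_eq {P : MatPencil n n} (h : P.IsRegular) :
    P.nrank = Fintype.card n := by
  obtain ⟨z, hz⟩ := h
  refine le_antisymm (ciSup_le fun z => rank_le_card_width _) ?_
  rw [← rank_of_det_ne_zero hz]
  exact P.rank_le_nrank z

theorem IsRegular.isEigenvalue_iff {P : MatPencil n n} (h : P.IsRegular) (μ : OnePoint ℂ) :
    P.IsEigenvalue μ ↔ (P.at' μ).det = 0 := by
  rw [IsEigenvalue, h.nrank_eq, rank_lt_card_iff]

theorem IsRegular.mem_eigs_iff {P : MatPencil n n} (h : P.IsRegular) (μ : OnePoint ℂ) :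
    μ ∈ P.eigs ↔ P.IsEigenvalue μ := by
  rw [h.isEigenvalue_iff, eigs, Multiset.mem_add, Multiset.mem_map, Multiset.mem_replicate]
  have h0 := P.isRegular_iff.1 h
  induction μ using OnePoint.rec with
  | infty =>
    have h1 := P.natDegree_charpoly_le
    have h2 : (-P.B).det = 0 ↔ P.B.det = 0 := by
      rw [det_neg]; simp
    rw [at'_infty, ← h2, ← coeff_charpoly_card]
    constructor
    · rintro (⟨z, -, hz⟩ | ⟨h3, -⟩)
      · exact absurd hz (OnePoint.coe_ne_infty z)
      · exact Polynomial.coeff_eq_zero_of_natDegree_lt (by omega)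
    · intro h3
      refine Or.inr ⟨fun h4 => ?_, rfl⟩
      have h5 : Fintype.card n = P.charpoly.natDegree := by omega
      rw [h5, Polynomial.coeff_natDegree, Polynomial.leadingCoeff_eq_zero] at h3
      exact h0 h3
  | coe z =>
    rw [← eval_charpoly]
    constructor
    · rintro (⟨w, hw, hz⟩ | ⟨-, h3⟩)
      · have : w = z := OnePoint.coe_injective hz
        subst this
        exact (Polynomial.mem_roots h0).1 hw
      · exact absurd h3 (OnePoint.coe_ne_infty z)
    · intro h3
      exact Or.inl ⟨z, (Polynomial.mem_roots h0).2 h3, rfl⟩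

theorem eigs_eq_add {m' : Type} [Fintype m'] [DecidableEq m'] {m : Type} [Fintype m]
    [DecidableEq m] {P : MatPencil n n} {P₁ : MatPencil m m} {P₂ : MatPencil m' m'} {c : ℂ}
    (hc : c ≠ 0) (h₁ : P₁.IsRegular) (h₂ : P₂.IsRegular)
    (h : P.charpoly = Polynomial.C c * (P₁.charpoly * P₂.charpoly))
    (hcard : Fintype.card n = Fintype.card m + Fintype.card m') :
    P.eigs = P₁.eigs + P₂.eigs := by
  have h1 := P₁.isRegular_iff.1 h₁
  have h2 := P₂.isRegular_iff.1 h₂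
  -- The multiplicities of `∞` are truncated differences; they add up only because each degree is at
  -- most its size.
  have l1 := P₁.natDegree_charpoly_le
  have l2 := P₂.natDegree_charpoly_le
  rw [eigs, eigs, eigs, h, Polynomial.roots_C_mul _ hc, Polynomial.roots_mul (mul_ne_zero h1 h2),
    Polynomial.natDegree_C_mul hc, Polynomial.natDegree_mul h1 h2, hcard, Multiset.map_add,
    show Fintype.card m + Fintype.card m' - (P₁.charpoly.natDegree + P₂.charpoly.natDegree) =
      (Fintype.card m - P₁.charpoly.natDegree) + (Fintype.card m' - P₂.charpoly.natDegree) by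
      omega, Multiset.replicate_add]
  abel

theorem charpoly_directSum {m : Type} [Fintype m] [DecidableEq m] (P : MatPencil n n)
    (P' : MatPencil m m) : (P.directSum P').charpoly = P.charpoly * P'.charpoly := by
  refine Polynomial.funext fun z => ?_
  rw [Polynomial.eval_mul, eval_charpoly, eval_charpoly, eval_charpoly, at'_directSum,
    det_fromBlocks_zero₂₁]

theorem IsRegular.directSum {m : Type} [Fintype m] [DecidableEq m] {P : MatPencil n n}
    {P' : MatPencil m m} (h : P.IsRegular) (h' : P'.IsRegular) : (P.directSum P').IsRegular := by
  rw [isRegular_iff] at *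
  rw [charpoly_directSum]
  exact mul_ne_zero h h'

theorem StrictEquiv.exists_charpoly_eq {m : Type} [Fintype m] [DecidableEq m]
    {P : MatPencil n n} {P' : MatPencil m m} (h : P.StrictEquiv P') :
    ∃ c : ℂ, c ≠ 0 ∧ P.charpoly = Polynomial.C c * P'.charpoly := by
  obtain ⟨e, f, S, T, hS, hT, hST⟩ := h.at'_eq
  obtain ⟨c, hc, hdet⟩ := exists_det_submatrix_equiv_eq e f
  have hS' := ((isUnit_iff_isUnit_det S).1 hS).ne_zero
  have hT' := ((isUnit_iff_isUnit_det T).1 hT).ne_zero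
  refine ⟨c / (S.det * T.det), div_ne_zero hc (mul_ne_zero hS' hT'), Polynomial.funext fun z => ?_⟩
  have := congrArg Matrix.det (hST z)
  rw [det_mul, det_mul, hdet] at this
  rw [Polynomial.eval_mul, Polynomial.eval_C, eval_charpoly, eval_charpoly, div_mul_eq_mul_div,
    eq_div_iff (mul_ne_zero hS' hT'), ← this]
  ring

end Square

end MatPencil

/-! ### Projecting away the perturbation -/

namespace Matrix

/-- The rank of the block matrix is `rank A` plus the rank of the Schur complement, so the bound
makes the Schur complement zero. Adding `E` to the corner then makes it equal to `E`. -/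
theorem det_fromBlocks_of_rank_le {m κ : Type*} [Fintype m] [DecidableEq m] [Fintype κ]
    [DecidableEq κ] (A : Matrix m m ℂ) (B : Matrix m κ ℂ) (C : Matrix κ m ℂ) (D E : Matrix κ κ ℂ)
    (hA : A.det ≠ 0) (hr : (fromBlocks A B C D).rank ≤ Fintype.card m) :
    (fromBlocks A B C (D + E)).det = A.det * E.det := by
  let := invertibleOfIsUnitDet A (isUnit_iff_ne_zero.2 hA)
  have h := fromBlocks_eq_of_invertible₁₁ A B C D
  have h1 : (fromBlocks A B C D).rank = (fromBlocks A 0 0 (D - C * ⅟ A * B)).rank := by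
    rw [h, rank_mul_eq_left_of_isUnit_det, rank_mul_eq_right_of_isUnit_det]
    · simp
    · simp
  rw [h1, rank_fromBlocks_diag, rank_of_det_ne_zero hA] at hr
  have h2 : D - C * ⅟ A * B = 0 := by
    have h3 : (D - C * ⅟ A * B).rank = 0 := by omega
    have h4 := rank_add_finrank_ker (D - C * ⅟ A * B)
    have h5 : LinearMap.ker (D - C * ⅟ A * B).mulVecLin = ⊤ :=
      Submodule.eq_top_of_finrank_eq (by rw [Module.finrank_fintype_fun_eq_card]; omega)
    rw [LinearMap.ker_eq_top] at h5
    ext i j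
    have h6 := congrFun (LinearMap.congr_fun h5 (Pi.single j 1)) i
    rw [mulVecLin_apply, mulVec_single_one] at h6
    exact h6
  rw [det_fromBlocks₁₁, add_sub_right_comm, h2, zero_add]

end Matrix

section OrthCompl

variable {n k : ℕ} {U : Matrix (Fin n) (Fin k) ℂ} {W : Matrix (Fin n) (Fin (n - k)) ℂ}

theorem IsOrthComplBasis.conjTranspose_mul (h : IsOrthComplBasis U W) : Uᴴ * W = 0 := by
  ext i j
  have h1 := (h.2 (fun i => W i j)).1 (Submodule.subset_span ⟨j, rfl⟩) (Pi.single i 1)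
  rw [dotProduct_star_mulVec] at h1
  have h2 : (Uᴴ *ᵥ fun i => W i j) i = 0 := by simpa [Pi.star_single] using h1
  exact h2

theorem IsOrthComplBasis.conjTranspose_mul' (h : IsOrthComplBasis U W) : Wᴴ * U = 0 := by
  have h1 := congrArg conjTranspose h.conjTranspose_mul
  rwa [Matrix.conjTranspose_mul, conjTranspose_conjTranspose, conjTranspose_zero] at h1

open scoped ComplexOrder in
-- The kernel of `U*` has dimension `n - rank U`, and it is spanned by `n - k` independent columns.
-- Thus full column rank of `U` is a consequence of the existence of `W`; `hk` guards against
-- truncation in `n - k`.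
theorem IsOrthComplBasis.rank_eq (h : IsOrthComplBasis U W) (hk : k ≤ n) : U.rank = k := by
  have h1 : Submodule.span ℂ (Set.range (fun j : Fin (n - k) => fun i : Fin n => W i j)) =
      LinearMap.ker Uᴴ.mulVecLin := by
    ext w
    rw [h.2 w, LinearMap.mem_ker, mulVecLin_apply]
    constructor
    · intro hw
      ext i
      have h2 := hw (Pi.single i 1)
      rw [dotProduct_star_mulVec] at h2
      simpa [Pi.star_single] using h2
    · intro hw c
      rw [dotProduct_star_mulVec, hw, dotProduct_zero]
  have h2 := finrank_span_eq_card h.1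
  have h3 := rank_add_finrank_ker Uᴴ
  rw [rank_conjTranspose, ← h1, h2, Fintype.card_fin, Fintype.card_fin] at h3
  omega

open scoped ComplexOrder in
theorem det_conjTranspose_mul_self_ne_zero {m p : Type} [Fintype m] [Fintype p] [DecidableEq p]
    {M : Matrix m p ℂ} (h : M.rank = Fintype.card p) : (Mᴴ * M).det ≠ 0 := by
  intro h0
  have := (MatPencil.rank_lt_card_iff _).2 h0
  rw [rank_conjTranspose_mul_self] at this
  omega

/-- The square matrix `[W U]` of a matrix and a basis of the complement of its range. -/
def orthComplFrame (U : Matrix (Fin n) (Fin k) ℂ) (W : Matrix (Fin n) (Fin (n - k)) ℂ)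
    (e : Fin n ≃ Fin (n - k) ⊕ Fin k) : Matrix (Fin n) (Fin n) ℂ :=
  (fromCols W U).submatrix id e

theorem frame_conj_mul {V : Matrix (Fin n) (Fin k) ℂ} {Z : Matrix (Fin n) (Fin (n - k)) ℂ}
    (e : Fin n ≃ Fin (n - k) ⊕ Fin k) (M : Matrix (Fin n) (Fin n) ℂ) :
    (orthComplFrame U W e)ᴴ * M * orthComplFrame V Z e =
      (fromBlocks (Wᴴ * M * Z) (Wᴴ * M * V) (Uᴴ * M * Z) (Uᴴ * M * V)).submatrix e e := by
  have h1 : (orthComplFrame U W e)ᴴ = (fromRows Wᴴ Uᴴ).submatrix e id := by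
    rw [orthComplFrame, conjTranspose_submatrix, conjTranspose_fromCols_eq_fromRows_conjTranspose]
  have h2 : (orthComplFrame U W e)ᴴ * M * orthComplFrame V Z e =
      (fromRows Wᴴ Uᴴ * M * fromCols Z V).submatrix e e := by
    rw [h1]
    rfl
  rw [h2, fromRows_mul, fromRows_mul_fromCols]

/-- By orthogonality the Gram matrix of `[W U]` is block diagonal, and both Gram blocks are
invertible by full column rank. -/
theorem IsOrthComplBasis.det_frame_ne_zero (h : IsOrthComplBasis U W) (hk : k ≤ n)
    (e : Fin n ≃ Fin (n - k) ⊕ Fin k) : (orthComplFrame U W e).det ≠ 0 := by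
  have h1 : (orthComplFrame U W e)ᴴ * orthComplFrame U W e =
      (fromBlocks (Wᴴ * W) 0 0 (Uᴴ * U)).submatrix e e := by
    have h0 := h.conjTranspose_mul'
    have h3 := frame_conj_mul (U := U) (W := W) (V := U) (Z := W) e 1
    simpa only [Matrix.mul_one, h0, h.conjTranspose_mul] using h3
  intro h0
  have h2 := congrArg Matrix.det h1
  rw [det_mul, h0, mul_zero, det_submatrix_equiv_self, det_fromBlocks_zero₂₁] at h2
  refine mul_ne_zero (det_conjTranspose_mul_self_ne_zero ?_)
    (det_conjTranspose_mul_self_ne_zero ?_) h2.symm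
  · rw [rank_eq_finrank_span_cols]
    exact finrank_span_eq_card h.1
  · rw [h.rank_eq hk, Fintype.card_fin]

open MatPencil

/-- Projecting away the perturbation divides the characteristic polynomial by the prescribed one. -/
theorem exists_charpoly_perturb_eq (hk : k ≤ n) {P : MatPencil (Fin n) (Fin n)}
    (hrank : P.nrank ≤ n - k)
    (D : MatPencil (Fin k) (Fin k)) {V : Matrix (Fin n) (Fin k) ℂ} {τ : ℂ} (hτ : τ ≠ 0)
    {Z : Matrix (Fin n) (Fin (n - k)) ℂ} (hU : IsOrthComplBasis U W) (hV : IsOrthComplBasis V Z)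
    (hreg : (P.compress W Z).IsRegular) :
    ∃ c : ℂ, c ≠ 0 ∧ (P.perturb D U V τ).charpoly =
      Polynomial.C c * ((P.compress W Z).charpoly * D.charpoly) := by
  let e : Fin n ≃ Fin (n - k) ⊕ Fin k := (finCongr (by omega)).trans finSumFinEquiv.symm
  have hE := hU.det_frame_ne_zero hk e
  have hF := hV.det_frame_ne_zero hk e
  set E := orthComplFrame U W e with hEdef
  set F := orthComplFrame V Z e with hFdef
  have hU0 : (Uᴴ * U).det ≠ 0 :=
    det_conjTranspose_mul_self_ne_zero (by rw [hU.rank_eq hk, Fintype.card_fin])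
  have hV0 : (Vᴴ * V).det ≠ 0 :=
    det_conjTranspose_mul_self_ne_zero (by rw [hV.rank_eq hk, Fintype.card_fin])
  have hWU := hU.conjTranspose_mul'
  have hVZ := hV.conjTranspose_mul
  have hE' : Eᴴ.det ≠ 0 := by rw [det_conjTranspose]; exact star_ne_zero.2 hE
  -- The Schur complement argument needs the leading block to be invertible, hence the restriction
  -- on `z`.
  have key : ∀ z : ℂ, (P.compress W Z).charpoly.eval z ≠ 0 →
      Eᴴ.det * ((P.perturb D U V τ).at' z).det * F.det = ((P.compress W Z).at' z).det *
        (τ ^ k * ((Uᴴ * U).det * (D.at' z).det * (Vᴴ * V).det)) := by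
    intro z hz
    rw [MatPencil.eval_charpoly] at hz
    have h1 := frame_conj_mul (U := U) (W := W) (V := V) (Z := Z) e ((P.perturb D U V τ).at' z)
    have h2 := frame_conj_mul (U := U) (W := W) (V := V) (Z := Z) e (P.at' z)
    rw [← hEdef, ← hFdef] at h1 h2
    have h3 : (fromBlocks (Wᴴ * P.at' z * Z) (Wᴴ * P.at' z * V) (Uᴴ * P.at' z * Z)
        (Uᴴ * P.at' z * V)).rank ≤ Fintype.card (Fin (n - k)) := by
      rw [← rank_submatrix _ e e, ← h2, Fintype.card_fin]
      exact (rank_mul_le_left _ _).trans ((rank_mul_le_right _ _).trans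
        ((P.rank_le_nrank z).trans hrank))
    rw [at'_compress] at hz ⊢
    have h4 := det_fromBlocks_of_rank_le _ _ _ _ (τ • (Uᴴ * U * D.at' z * (Vᴴ * V))) hz h3
    have h5 : Wᴴ * (P.perturb D U V τ).at' z * Z = Wᴴ * P.at' z * Z := by
      rw [at'_perturb, Matrix.mul_add, Matrix.add_mul, Matrix.mul_smul, ← Matrix.mul_assoc,
        ← Matrix.mul_assoc, hWU]
      simp
    have h6 : Wᴴ * (P.perturb D U V τ).at' z * V = Wᴴ * P.at' z * V := by
      rw [at'_perturb, Matrix.mul_add, Matrix.add_mul, Matrix.mul_smul, ← Matrix.mul_assoc,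
        ← Matrix.mul_assoc, hWU]
      simp
    have h7 : Uᴴ * (P.perturb D U V τ).at' z * Z = Uᴴ * P.at' z * Z := by
      rw [at'_perturb, Matrix.mul_add, Matrix.add_mul, Matrix.mul_smul, Matrix.smul_mul,
        ← Matrix.mul_assoc Uᴴ (U * _) Vᴴ, Matrix.mul_assoc _ Vᴴ Z, hVZ]
      simp
    have h8 : Uᴴ * (P.perturb D U V τ).at' z * V = Uᴴ * P.at' z * V +
        τ • (Uᴴ * U * D.at' z * (Vᴴ * V)) := by
      rw [at'_perturb, Matrix.mul_add, Matrix.add_mul, Matrix.mul_smul, Matrix.smul_mul]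
      simp only [Matrix.mul_assoc]
    have h9 := congrArg Matrix.det h1
    rw [det_mul, det_mul, det_submatrix_equiv_self, h5, h6, h7, h8, h4, det_smul, det_mul,
      det_mul, Fintype.card_fin] at h9
    exact h9
  have hEF : Eᴴ.det * F.det ≠ 0 := mul_ne_zero hE' hF
  refine ⟨τ ^ k * ((Uᴴ * U).det * (Vᴴ * V).det) / (Eᴴ.det * F.det),
    div_ne_zero (mul_ne_zero (pow_ne_zero _ hτ) (mul_ne_zero hU0 hV0)) hEF, ?_⟩
  -- Multiplying by the projected characteristic polynomial makes both sides vanish at the finitely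
  -- many points not covered by `key`.
  refine mul_left_cancel₀ ((isRegular_iff _).1 hreg) (Polynomial.funext fun z => ?_)
  rw [Polynomial.eval_mul, Polynomial.eval_mul]
  by_cases hz : (P.compress W Z).charpoly.eval z = 0
  · rw [hz, zero_mul, zero_mul]
  · have h1 := key z hz
    congr 1
    rw [Polynomial.eval_mul, Polynomial.eval_C, Polynomial.eval_mul, div_mul_eq_mul_div,
      eq_div_iff hEF, MatPencil.eval_charpoly, MatPencil.eval_charpoly, MatPencil.eval_charpoly]
    linear_combination h1

theorem MatPencil.StrictEquiv.card_eq {m n m' n' : Type} [Fintype m] [Fintype n] [DecidableEq m]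
    [DecidableEq n] [Fintype m'] {P : MatPencil m n} {P' : MatPencil m' n'}
    (h : P.StrictEquiv P') : Fintype.card m = Fintype.card m' :=
  Fintype.card_congr h.choose

/-- The eigenvalues of the projected pencil, for a perturbation that splits as `R`, `D`, `Ran`. -/
theorem eigs_compress_eq {ρ σ : Type} [Fintype ρ] [DecidableEq ρ] [Fintype σ] [DecidableEq σ]
    (hk : k ≤ n) {P : MatPencil (Fin n) (Fin n)} (hrank : P.nrank ≤ n - k)
    {D : MatPencil (Fin k) (Fin k)} (hD : D.IsRegular) {R : MatPencil ρ ρ} (hR : R.IsRegular)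
    {Ran : MatPencil σ σ} (hRan : Ran.IsRegular)
    {V : Matrix (Fin n) (Fin k) ℂ} {τ : ℂ} (hτ : τ ≠ 0)
    (hequiv : (P.perturb D U V τ).StrictEquiv (R.directSum (D.directSum Ran)))
    {Z : Matrix (Fin n) (Fin (n - k)) ℂ} (hU : IsOrthComplBasis U W) (hV : IsOrthComplBasis V Z)
    (hreg : (P.compress W Z).IsRegular) :
    (P.compress W Z).eigs = Ran.eigs + R.eigs := by
  obtain ⟨c, hc, h1⟩ := exists_charpoly_perturb_eq hk hrank D hτ hU hV hreg
  obtain ⟨d, hd, h2⟩ := hequiv.exists_charpoly_eq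
  have hcard := hequiv.card_eq
  simp only [Fintype.card_sum, Fintype.card_fin] at hcard
  refine eigs_eq_add (c := d / c) (div_ne_zero hd hc) hRan hR ?_ (by rw [Fintype.card_fin]; omega)
  rw [charpoly_directSum, charpoly_directSum, h1] at h2
  have hc' : Polynomial.C c * D.charpoly ≠ 0 :=
    mul_ne_zero (Polynomial.C_ne_zero.2 hc) (D.isRegular_iff.1 hD)
  refine mul_right_cancel₀ hc' ?_
  have h3 : Polynomial.C (d / c) * Polynomial.C c = Polynomial.C d := by
    rw [← Polynomial.C_mul, div_mul_cancel₀ _ hc]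
  linear_combination h2 - Ran.charpoly * R.charpoly * D.charpoly * h3

end OrthCompl

/-! ### Diagonalization of regular pencils by rank comparison -/

namespace Matrix

/-- The hypothesis says that the eigenspace of `M` at `s` has at least as many dimensions as `s` has
occurrences in `t`. That many independent eigenvectors are chosen for each `s`; since eigenspaces
for distinct `s` are independent, together they form a basis. -/
theorem exists_diagonalization {n : Type*} [Fintype n] [DecidableEq n] (M : Matrix n n ℂ)
    (t : n → ℂ) (h : ∀ s : ℂ, (M - s • 1).rank ≤ (diagonal t - s • 1).rank) :
    ∃ T : Matrix n n ℂ, IsUnit T ∧ M * T = T * diagonal t := by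
  have h1 : ∀ s : ℂ, ∃ w : {i // t i = s} → (n → ℂ), LinearIndependent ℂ w ∧
      ∀ i, w i ∈ Module.End.eigenspace (toLin' M) s := by
    intro s
    have h2 := rank_add_finrank_ker (M - s • 1)
    have h3 : (diagonal t - s • 1 : Matrix n n ℂ) = diagonal fun i => t i - s := by
      ext i j
      by_cases hij : i = j
      · subst hij; simp
      · simp [hij]
    have h4 := h s
    rw [h3, rank_diagonal] at h4
    have h5 : Fintype.card {i // t i = s} + Fintype.card {i // t i - s ≠ 0} = Fintype.card n := by
      have h6 : Fintype.card {i // t i - s ≠ 0} = Fintype.card {i // ¬ t i = s} :=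
        Fintype.card_congr (Equiv.subtypeEquivRight fun i => by rw [ne_eq, sub_eq_zero])
      rw [h6, Fintype.card_subtype_compl]
      exact Nat.add_sub_of_le (Fintype.card_subtype_le _)
    have h6 : LinearMap.ker (M - s • 1).mulVecLin = Module.End.eigenspace (toLin' M) s := by
      ext x
      rw [Module.End.mem_eigenspace_iff, LinearMap.mem_ker, mulVecLin_apply, sub_mulVec,
        smul_mulVec, one_mulVec, toLin'_apply, sub_eq_zero]
    rw [h6] at h2
    obtain ⟨f, hf⟩ := exists_linearIndependent_of_le_finrank (R := ℂ)
      (M := Module.End.eigenspace (toLin' M) s) (n := Fintype.card {i // t i = s}) (by omega)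
    refine ⟨fun i => f (Fintype.equivFin _ i), ?_, fun i => (f _).2⟩
    exact (hf.comp _ (Fintype.equivFin _).injective).map' (Submodule.subtype _)
      (Submodule.ker_subtype _)
  choose w hw hwm using h1
  let v : n → n → ℂ := fun i => w (t i) ⟨i, rfl⟩
  have hv : LinearIndependent ℂ v := by
    rw [Fintype.linearIndependent_iff]
    intro g hg
    have h2 := (iSupIndep_iff_finsetSum_eq_zero_imp_eq_zero _).1
      (Module.End.eigenspaces_iSupIndep (toLin' M)) (Finset.univ.image t)
      (fun s => ∑ i with t i = s, g i • v i) (fun s _ => Submodule.sum_mem _ fun i hi => by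
        rw [← (Finset.mem_filter.1 hi).2]
        exact Submodule.smul_mem _ _ (hwm _ _)) (by
        rw [Finset.sum_fiberwise_of_maps_to
          (fun i _ => Finset.mem_image_of_mem t (Finset.mem_univ i))]
        exact hg)
    intro i
    have h3 := h2 (t i) (Finset.mem_image_of_mem t (Finset.mem_univ i))
    rw [Finset.sum_subtype (p := fun j => t j = t i) _ (by simp)] at h3
    have h4 : ∑ j : {j // t j = t i}, g j • w (t i) j = 0 := by
      rw [← h3]
      refine Finset.sum_congr rfl fun j _ => ?_
      obtain ⟨j, hj⟩ := j
      simp only [v]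
      congr 1
      have : ∀ s (h : t j = s), w s ⟨j, h⟩ = w (t j) ⟨j, rfl⟩ := by
        rintro _ rfl
        rfl
      exact this _ hj
    exact Fintype.linearIndependent_iff.1 (hw (t i)) (fun j => g j) h4 ⟨i, rfl⟩
  refine ⟨(of v)ᵀ, ?_, ?_⟩
  · rw [← linearIndependent_cols_iff_isUnit]
    exact hv
  · ext i j
    have h2 := Module.End.mem_eigenspace_iff.1 (hwm (t j) ⟨j, rfl⟩)
    have h3 := congrFun h2 i
    rw [toLin'_apply] at h3
    rw [mul_diagonal]
    rw [Pi.smul_apply, smul_eq_mul, mul_comm] at h3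
    exact h3

end Matrix

namespace MatPencil

/-- The diagonal pencil with entries `a i - λ b i`. -/
def diag {ι : Type} [DecidableEq ι] (a b : ι → ℂ) : MatPencil ι ι where
  A := diagonal a
  B := diagonal b

theorem at'_diag {ι : Type} [DecidableEq ι] (a b : ι → ℂ) (μ : OnePoint ℂ) :
    (diag a b).at' μ = diagonal fun i => coeffA μ * a i + coeffB μ * b i := by
  rw [at'_eq, diag, ← diagonal_smul, ← diagonal_smul, diagonal_add]
  rfl

section

variable {ι n : Type} [DecidableEq ι] [Fintype ι] [Fintype n] [DecidableEq n]

/-- Since `B - s (A - z B) = -s (A - ((1 + s z) / s) B)`, a Möbius map carries `s` to `μ`, with `s =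
0` going to `∞`. The point `μ` serves all pencils at once, so two pencils can be compared at the
same point. -/
theorem exists_rank_inv_mul_sub_eq (z s : ℂ) : ∃ μ : OnePoint ℂ, ∀ P : MatPencil n n,
    IsUnit (P.at' z) → ((P.at' z)⁻¹ * P.B - s • 1).rank = (P.at' μ).rank := by
  have h0 : ∀ P : MatPencil n n, IsUnit (P.at' z) →
      ((P.at' z)⁻¹ * P.B - s • 1).rank = (P.B - s • P.at' z).rank := by
    intro P hP
    have hd := (isUnit_iff_isUnit_det _).1 hP
    rw [← rank_mul_eq_right_of_isUnit_det (P.at' z) _ hd, Matrix.mul_sub, ← Matrix.mul_assoc,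
      mul_nonsing_inv _ hd, Matrix.one_mul, Matrix.mul_smul, Matrix.mul_one]
  by_cases hs : s = 0
  · refine ⟨OnePoint.infty, fun P hP => ?_⟩
    rw [h0 P hP, hs, zero_smul, sub_zero, at'_infty]
  · refine ⟨(((1 + s * z) / s : ℂ) : OnePoint ℂ), fun P hP => ?_⟩
    rw [h0 P hP]
    have : P.B - s • P.at' z = (-s) • P.at' (((1 + s * z) / s : ℂ) : OnePoint ℂ) := by
      rw [at'_coe, at'_coe]
      ext i j
      simp only [Matrix.sub_apply, Matrix.smul_apply, smul_eq_mul]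
      field_simp
      ring
    rw [this, rank_smul_of_mem_nonZeroDivisors _
      (mem_nonZeroDivisors_of_ne_zero (neg_ne_zero.2 hs))]

/-- A regular pencil whose eigenspaces are at least as large as those of a regular diagonal pencil
is strictly equivalent to it. -/
theorem IsRegular.strictEquiv_diag {Q : MatPencil n n} (hQ : Q.IsRegular) {a b : ι → ℂ}
    (hE : (diag a b).IsRegular) (e : n ≃ ι)
    (hr : ∀ μ, (Q.at' μ).rank ≤ ((diag a b).at' μ).rank) : Q.StrictEquiv (diag a b) := by
  have h0 : Q.charpoly * (diag a b).charpoly ≠ 0 :=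
    mul_ne_zero (Q.isRegular_iff.1 hQ) ((diag a b).isRegular_iff.1 hE)
  -- A common point of invertibility reduces both pencils to single matrices `(A - z B)⁻¹ B`.
  obtain ⟨z, hz⟩ : ∃ z, (Q.charpoly * (diag a b).charpoly).eval z ≠ 0 := by
    by_contra hn
    push Not at hn
    exact h0 (Polynomial.funext fun z => by rw [hn z, Polynomial.eval_zero])
  rw [Polynomial.eval_mul, MatPencil.eval_charpoly, MatPencil.eval_charpoly, mul_ne_zero_iff] at hz
  obtain ⟨hzQ, hzE⟩ := hz
  have huQ : IsUnit (Q.at' z).det := isUnit_iff_ne_zero.2 hzQ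
  let E' : MatPencil n n := diag (a ∘ e) (b ∘ e)
  have hsub : ∀ μ, E'.at' μ = ((diag a b).at' μ).submatrix e e := by
    intro μ
    rw [at'_diag, at'_diag, submatrix_diagonal_equiv]
    rfl
  have hE'z : (E'.at' z).det ≠ 0 := by rwa [hsub, det_submatrix_equiv_self]
  have huE : IsUnit (E'.at' z).det := isUnit_iff_ne_zero.2 hE'z
  have hEd : E'.at' z = diagonal fun i => a (e i) - z * b (e i) := by
    rw [at'_diag]
    congr 1
    ext i
    change 1 * _ + -z * _ = _
    simp
    ring
  have hne : ∀ i, a (e i) - z * b (e i) ≠ 0 := by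
    intro i
    rw [hEd, det_diagonal] at hE'z
    exact Finset.prod_ne_zero_iff.1 hE'z i (Finset.mem_univ i)
  let t : n → ℂ := fun i => b (e i) / (a (e i) - z * b (e i))
  have ht : (E'.at' z)⁻¹ * E'.B = diagonal t := by
    have : E'.B = E'.at' z * diagonal t := by
      rw [hEd, diagonal_mul_diagonal]
      change diagonal (b ∘ e) = _
      congr 1
      ext i
      rw [mul_div_cancel₀ _ (hne i)]
      rfl
    rw [this, ← Matrix.mul_assoc, nonsing_inv_mul _ huE, Matrix.one_mul]
  obtain ⟨T, hT, hMT⟩ := exists_diagonalization ((Q.at' z)⁻¹ * Q.B) t (by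
    intro s
    obtain ⟨μ, hμ⟩ := exists_rank_inv_mul_sub_eq (n := n) z s
    rw [← ht, hμ _ ((isUnit_iff_isUnit_det _).2 huQ), hμ _ ((isUnit_iff_isUnit_det _).2 huE), hsub,
      rank_submatrix]
    exact hr μ)
  have hTd := (isUnit_iff_isUnit_det _).1 hT
  let w : n → ℂ := fun i => a (e i) - z * b (e i)
  have hB : T⁻¹ * (Q.at' z)⁻¹ * Q.B * T = diagonal t := by
    rw [Matrix.mul_assoc T⁻¹, Matrix.mul_assoc T⁻¹, hMT, ← Matrix.mul_assoc,
      nonsing_inv_mul _ hTd, Matrix.one_mul]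
  have hQA : Q.A = Q.at' z + z • Q.B := by rw [at'_coe]; simp
  have hA : T⁻¹ * (Q.at' z)⁻¹ * Q.A * T = 1 + z • diagonal t := by
    rw [hQA, Matrix.mul_add, Matrix.add_mul, Matrix.mul_smul, Matrix.smul_mul, hB,
      Matrix.mul_assoc T⁻¹, nonsing_inv_mul _ huQ, Matrix.mul_one, nonsing_inv_mul _ hTd]
  -- `T⁻¹ Q(z)⁻¹` and `T` turn `(A, B)` into `(1 + z t, t)`; as `t = b / w` and `w = a - z b`,
  -- scaling rows by `w` gives `(a, b)`.
  refine ⟨e, e, diagonal w * (T⁻¹ * (Q.at' z)⁻¹), T, ?_, hT, ?_, ?_⟩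
  · rw [isUnit_iff_isUnit_det, det_mul, det_mul, det_diagonal]
    refine IsUnit.mul (isUnit_iff_ne_zero.2 (Finset.prod_ne_zero_iff.2 fun i _ => hne i)) ?_
    exact IsUnit.mul (isUnit_nonsing_inv_det _ hTd) (isUnit_nonsing_inv_det _ huQ)
  · rw [Matrix.mul_assoc (diagonal w), Matrix.mul_assoc (diagonal w), hA]
    ext i j
    by_cases hij : i = j
    · subst hij
      have := hne i
      simp [diag, w, t]
      field_simp
      ring
    · simp [diag, hij]
  · rw [Matrix.mul_assoc (diagonal w), Matrix.mul_assoc (diagonal w), hB, diagonal_mul_diagonal]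
    ext i j
    by_cases hij : i = j
    · subst hij
      have := hne i
      simp [diag, w, t]
      field_simp
    · simp [diag, hij]

end

end MatPencil

/-! ### Singular blocks and their kernels -/

namespace Matrix

variable {o : Type*} [Fintype o] [DecidableEq o] {m' n' : o → Type*} [∀ i, Fintype (n' i)]

theorem blockDiagonal'_mulVec_apply (M : ∀ i, Matrix (m' i) (n' i) ℂ)
    (x : (Σ i, n' i) → ℂ) (i : o) (a : m' i) :
    (blockDiagonal' M *ᵥ x) ⟨i, a⟩ = (M i *ᵥ fun b => x ⟨i, b⟩) a := by
  simp only [mulVec, dotProduct, Fintype.sum_sigma]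
  rw [Finset.sum_eq_single i]
  · simp
  · intro j _ hj
    exact Finset.sum_eq_zero fun b _ => by rw [blockDiagonal'_apply_ne _ _ _ (Ne.symm hj), zero_mul]
  · simp

theorem rank_blockDiagonal'_of_injective (M : ∀ i, Matrix (m' i) (n' i) ℂ)
    (h : ∀ i x, M i *ᵥ x = 0 → x = 0) :
    (blockDiagonal' M).rank = Fintype.card (Σ i, n' i) := by
  refine rank_eq_card_of_injective fun x hx => ?_
  ext ⟨i, b⟩
  refine congrFun (h i (fun b => x ⟨i, b⟩) ?_) b
  ext a
  rw [← blockDiagonal'_mulVec_apply, hx]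
  rfl

end Matrix

namespace MatPencil

/-- The singular block `L_d = [0 I_d] - λ [I_d 0]`. -/
def rightBlock (d : ℕ) : MatPencil (Fin d) (Fin (d + 1)) where
  A := blockZeroOne d
  B := blockOneZero d

theorem rightBlock_mulVec (d : ℕ) (μ : OnePoint ℂ) (x : Fin (d + 1) → ℂ) (i : Fin d) :
    ((rightBlock d).at' μ *ᵥ x) i = coeffA μ * x i.succ + coeffB μ * x i.castSucc := by
  rw [at'_eq, add_mulVec, smul_mulVec, smul_mulVec]
  simp [rightBlock, blockZeroOne, blockOneZero, mulVec, dotProduct]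

theorem rightBlock_transpose_mulVec (d : ℕ) (μ : OnePoint ℂ) (y : Fin d → ℂ) (j : Fin (d + 1)) :
    (((rightBlock d).at' μ)ᵀ *ᵥ y) j =
      coeffA μ * (∑ i, if j = i.succ then y i else 0) +
      coeffB μ * (∑ i, if j = i.castSucc then y i else 0) := by
  rw [at'_eq, transpose_add, transpose_smul, transpose_smul, add_mulVec, smul_mulVec, smul_mulVec]
  simp [rightBlock, blockZeroOne, blockOneZero, mulVec, dotProduct]

/-- At `∞` the vector is just padded by a zero. At a finite point the last equation kills the last
coordinate, and the remaining ones follow by back substitution. -/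
theorem rightBlock_transpose_injective (d : ℕ) (μ : OnePoint ℂ) (y : Fin d → ℂ)
    (h : ((rightBlock d).at' μ)ᵀ *ᵥ y = 0) : y = 0 := by
  induction μ using OnePoint.rec with
  | infty =>
    ext i
    have h1 := congrFun h i.castSucc
    rw [rightBlock_transpose_mulVec] at h1
    have hA : coeffA OnePoint.infty = 0 := rfl
    have hB : coeffB OnePoint.infty = 1 := rfl
    simpa [hA, hB, Fin.castSucc_inj] using h1
  | coe z =>
    have hA : coeffA (z : OnePoint ℂ) = 1 := rfl
    have hB : coeffB (z : OnePoint ℂ) = -z := rfl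
    -- Induction on the distance of `i` from the end; `r = 0` is vacuous because `i < d`.
    have key : ∀ r : ℕ, ∀ i : Fin d, d - i ≤ r → y i = 0 := by
      intro r
      induction r with
      | zero => intro i hi; omega
      | succ r ih =>
        intro i hi
        have h1 := congrFun h i.succ
        rw [rightBlock_transpose_mulVec, hA, hB] at h1
        have h2 : (∑ l : Fin d, if i.succ = l.castSucc then y l else 0) = 0 := by
          refine Finset.sum_eq_zero fun l _ => ?_
          split_ifs with hl
          · refine ih l ?_
            have := congrArg Fin.val hl
            simp only [Fin.val_succ, Fin.val_castSucc] at this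
            omega
          · rfl
        rw [h2] at h1
        simpa [Fin.succ_inj] using h1
    ext i
    exact key d i (by omega)

/-- The kernel vector of `L_d` at a point of `ℂ ∪ {∞}`: `(1, z, …, z ^ d)` and `(0, …, 0, 1)`. -/
def rightKernel (d : ℕ) : OnePoint ℂ → Fin (d + 1) → ℂ
  | OnePoint.infty => fun j => if j = Fin.last d then 1 else 0
  | OnePoint.some z => fun j => z ^ (j : ℕ)

theorem rightBlock_mulVec_rightKernel (d : ℕ) (μ : OnePoint ℂ) :
    (rightBlock d).at' μ *ᵥ rightKernel d μ = 0 := by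
  ext i
  rw [rightBlock_mulVec]
  rcases μ with _ | z
  · change (0 : ℂ) * _ + 1 * (if i.castSucc = Fin.last d then 1 else 0) = 0
    rw [if_neg (Fin.castSucc_lt_last i).ne]
    simp
  · change (1 : ℂ) * z ^ (i.succ : ℕ) + -z * z ^ (i.castSucc : ℕ) = 0
    rw [Fin.val_succ, Fin.val_castSucc]
    ring

theorem exists_rightKernel_eq_one (d : ℕ) (μ : OnePoint ℂ) : ∃ j, rightKernel d μ j = 1 := by
  rcases μ with _ | z
  · exact ⟨Fin.last d, if_pos rfl⟩
  · exact ⟨0, pow_zero z⟩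

/-- The kernel of `diag (L_{m_1}, …, L_{m_k})` at a point of `ℂ ∪ {∞}`. -/
def kernelMatrix {k : ℕ} (m : Fin k → ℕ) (μ : OnePoint ℂ) :
    Matrix (Σ i, Fin (m i + 1)) (Fin k) ℂ :=
  of fun p l => if p.1 = l then rightKernel (m p.1) μ p.2 else 0

theorem kernelMatrix_mulVec {k : ℕ} (m : Fin k → ℕ) (μ : OnePoint ℂ) (c : Fin k → ℂ)
    (p : Σ i, Fin (m i + 1)) :
    (kernelMatrix m μ *ᵥ c) p = rightKernel (m p.1) μ p.2 * c p.1 := by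
  simp [kernelMatrix, mulVec, dotProduct]

theorem kernelMatrix_injective {k : ℕ} (m : Fin k → ℕ) (μ : OnePoint ℂ) (c : Fin k → ℂ)
    (h : kernelMatrix m μ *ᵥ c = 0) : c = 0 := by
  ext i
  obtain ⟨j, hj⟩ := exists_rightKernel_eq_one (m i) μ
  have h1 := congrFun h ⟨i, j⟩
  rw [kernelMatrix_mulVec] at h1
  simpa [hj] using h1

/-- The pencil `diag (L_{m_1}, …, L_{m_k})`. -/
def rightBlocks {k : ℕ} (m : Fin k → ℕ) :
    MatPencil (Σ i, Fin (m i)) (Σ i, Fin (m i + 1)) where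
  A := blockDiagonal' fun i => blockZeroOne (m i)
  B := blockDiagonal' fun i => blockOneZero (m i)

theorem at'_rightBlocks {k : ℕ} (m : Fin k → ℕ) (μ : OnePoint ℂ) :
    (rightBlocks m).at' μ = blockDiagonal' fun i => (rightBlock (m i)).at' μ := by
  simp only [at'_eq, rightBlocks, rightBlock, ← blockDiagonal'_smul, ← blockDiagonal'_add]
  rfl

theorem rightBlocks_mul_kernelMatrix {k : ℕ} (m : Fin k → ℕ) (μ : OnePoint ℂ) (c : Fin k → ℂ) :
    (rightBlocks m).at' μ *ᵥ (kernelMatrix m μ *ᵥ c) = 0 := by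
  ext ⟨i, a⟩
  rw [at'_rightBlocks, blockDiagonal'_mulVec_apply]
  have h : (fun b => (kernelMatrix m μ *ᵥ c) ⟨i, b⟩) = c i • rightKernel (m i) μ := by
    ext b
    rw [kernelMatrix_mulVec, Pi.smul_apply, smul_eq_mul, mul_comm]
  rw [h, mulVec_smul, rightBlock_mulVec_rightKernel, smul_zero]
  rfl

theorem rank_rightBlocks_transpose {k : ℕ} (m : Fin k → ℕ) (μ : OnePoint ℂ) :
    (((rightBlocks m).at' μ)ᵀ).rank = Fintype.card (Σ i, Fin (m i)) := by
  rw [at'_rightBlocks, blockDiagonal'_transpose]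
  exact rank_blockDiagonal'_of_injective _ fun i x hx => rightBlock_transpose_injective _ μ x hx

theorem rank_rightBlocks {k : ℕ} (m : Fin k → ℕ) (μ : OnePoint ℂ) :
    ((rightBlocks m).at' μ).rank = Fintype.card (Σ i, Fin (m i)) := by
  rw [← rank_transpose, rank_rightBlocks_transpose]

theorem directSum_diag {ι κ : Type} [DecidableEq ι] [DecidableEq κ] (a b : ι → ℂ) (c d : κ → ℂ) :
    (diag a b).directSum (diag c d) = diag (Sum.elim a c) (Sum.elim b d) := by
  simp only [directSum, diag, fromBlocks_diagonal]

section Diag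

variable {ι : Type} [DecidableEq ι] [Fintype ι]

theorem isRegular_diag_iff {a b : ι → ℂ} :
    (diag a b).IsRegular ↔ ∃ z : ℂ, ∀ i, a i - z * b i ≠ 0 := by
  refine exists_congr fun z => ?_
  have : (diag a b).A - z • (diag a b).B = diagonal fun i => a i - z * b i := by
    rw [diag, ← diagonal_smul, diagonal_sub]
    rfl
  rw [this, det_diagonal, Finset.prod_ne_zero_iff]
  simp

end Diag

end MatPencil

/-! ### Consequences of the Kronecker form -/

namespace KroneckerData

open MatPencil

variable (K : KroneckerData)

theorem blockDiagonal'_jordanBlock {c : ℕ} {d : Fin c → ℕ} (hd : ∀ i, d i = 1) (z : Fin c → ℂ) :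
    (blockDiagonal' fun i => jordanBlock (d i) (z i)) = diagonal fun p => z p.1 := by
  ext ⟨i, a⟩ ⟨j, b⟩
  by_cases hij : i = j
  · subst hij
    have hab : a = b := by
      have := hd i
      ext
      omega
    subst hab
    simp [jordanBlock]
  · rw [blockDiagonal'_apply_ne _ _ _ hij, diagonal_apply_ne]
    intro h
    exact hij (congrArg Sigma.fst h)

theorem regularPart_eq_diag (h : K.Semisimple) :
    K.regularPart = MatPencil.diag (Sum.elim (fun p => K.finEig p.1) fun _ => 1)
      (Sum.elim (fun _ => 1) fun _ => 0) := by
  rw [regularPart, blockDiagonal'_jordanBlock h.1,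
    blockDiagonal'_jordanBlock (z := fun _ => 0) h.2, MatPencil.diag, ← fromBlocks_diagonal,
    ← fromBlocks_diagonal]
  simp only [diagonal_one]

theorem isRegular_regularPart (h : K.Semisimple) : K.regularPart.IsRegular := by
  rw [K.regularPart_eq_diag h, isRegular_diag_iff]
  obtain ⟨z, hz⟩ := (Set.finite_range K.finEig).infinite_compl.nonempty
  refine ⟨z, ?_⟩
  rintro (p | p)
  · simp only [Sum.elim_inl, mul_one]
    exact sub_ne_zero.2 fun hp => hz ⟨p.1, hp⟩
  · simp

theorem at'_singularPart (μ : OnePoint ℂ) :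
    K.singularPart.at' μ = fromBlocks ((rightBlocks K.rightIndex).at' μ) 0 0
      ((rightBlocks K.leftIndex).at' μ)ᵀ := by
  simp only [at'_eq, singularPart, fromBlocks_smul, fromBlocks_add, smul_zero, add_zero,
    rightBlocks, transpose_add, transpose_smul, blockDiagonal'_transpose]

/-- The rank does not depend on `μ`, so every rank drop of the pencil comes from the regular part.
-/
theorem rank_singularPart (μ : OnePoint ℂ) :
    (K.singularPart.at' μ).rank =
      Fintype.card (Σ i, Fin (K.rightIndex i)) + Fintype.card (Σ i, Fin (K.leftIndex i)) := by
  rw [at'_singularPart, rank_fromBlocks_diag, rank_rightBlocks, rank_rightBlocks_transpose]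

end KroneckerData

namespace MatPencil

section KCF

variable {n k : ℕ} {P : MatPencil (Fin n) (Fin n)} {K : KroneckerData}

theorem IsKCF.rank_eq (hK : P.IsKCF K) (μ : OnePoint ℂ) :
    (P.at' μ).rank = (K.regularPart.at' μ).rank +
      (Fintype.card (Σ i, Fin (K.rightIndex i)) + Fintype.card (Σ i, Fin (K.leftIndex i))) := by
  rw [StrictEquiv.rank_eq hK, rank_directSum, K.rank_singularPart]

theorem IsKCF.nrank_eq (hK : P.IsKCF K) (hss : K.Semisimple) :
    P.nrank = Fintype.card K.RegIdx +
      (Fintype.card (Σ i, Fin (K.rightIndex i)) + Fintype.card (Σ i, Fin (K.leftIndex i))) := by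
  refine le_antisymm (ciSup_le fun z => ?_) ?_
  · rw [← at'_coe, hK.rank_eq]
    exact Nat.add_le_add_right (rank_le_card_width _) _
  · obtain ⟨z, hz⟩ := K.isRegular_regularPart hss
    rw [← rank_of_det_ne_zero hz, ← at'_coe, ← hK.rank_eq]
    exact P.rank_le_nrank z

theorem IsKCF.isEigenvalue_iff (hK : P.IsKCF K) (hss : K.Semisimple) (μ : OnePoint ℂ) :
    P.IsEigenvalue μ ↔ K.regularPart.IsEigenvalue μ := by
  rw [IsEigenvalue, IsEigenvalue, hK.nrank_eq hss, hK.rank_eq,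
    (K.isRegular_regularPart hss).nrank_eq]
  omega

/-- The rows exceed the normal rank by one for each left block and the columns by one for each right
block; both excesses are `k`. -/
theorem IsKCF.num_eq (hK : P.IsKCF K) (hss : K.Semisimple) (hrank : P.nrank + k = n) :
    K.numRight = k ∧ K.numLeft = k := by
  have h1 := hK.nrank_eq hss
  obtain ⟨e, f, -⟩ := hK
  have h2 := Fintype.card_congr e
  have h3 := Fintype.card_congr f
  simp only [Fintype.card_fin, Fintype.card_sum, Fintype.card_sigma, Finset.sum_add_distrib,
    Finset.sum_const, Finset.card_univ, smul_eq_mul, mul_one] at h1 h2 h3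
  omega

/-- `P` contains the blocks `L_{m_1}, …, L_{m_k}`: it maps the span of the independent columns of
`T` to that of the columns of `G` as the direct sum of these blocks does. -/
def HasRightBlocks (P : MatPencil (Fin n) (Fin n)) (m : Fin k → ℕ) : Prop :=
  ∃ (T : Matrix (Fin n) (Σ i, Fin (m i + 1)) ℂ) (T' : Matrix (Σ i, Fin (m i + 1)) (Fin n) ℂ)
    (G : Matrix (Fin n) (Σ i, Fin (m i)) ℂ),
    T' * T = 1 ∧ ∀ μ, P.at' μ * T = G * (rightBlocks m).at' μ

/-- `J` and `J'` pick the columns and rows of the canonical form that belong to the blocks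
`L_{m_i}`; the equivalence carries them back to `P`. -/
theorem hasRightBlocks_of_strictEquiv {m : Fin k → ℕ} {p q : Type}
    [Fintype p] [Fintype q]
    {e : Fin n ≃ p} {f : Fin n ≃ q} {S T : Matrix (Fin n) (Fin n) ℂ} (hS : IsUnit S)
    (hT : IsUnit T) {C : OnePoint ℂ → Matrix p q ℂ}
    (h : ∀ μ, S * P.at' μ * T = (C μ).submatrix e f)
    (J : Matrix q (Σ i, Fin (m i + 1)) ℂ) (J' : Matrix p (Σ i, Fin (m i)) ℂ)
    (hJ : Jᵀ * J = 1) (hC : ∀ μ, C μ * J = J' * (rightBlocks m).at' μ) : P.HasRightBlocks m := by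
  have hSd := (isUnit_iff_isUnit_det _).1 hS
  have hTd := (isUnit_iff_isUnit_det _).1 hT
  refine ⟨T * J.submatrix f id, (J.submatrix f id)ᵀ * T⁻¹, S⁻¹ * J'.submatrix e id, ?_, ?_⟩
  · rw [Matrix.mul_assoc, ← Matrix.mul_assoc T⁻¹, nonsing_inv_mul _ hTd, Matrix.one_mul,
      transpose_submatrix, submatrix_mul_equiv, hJ, submatrix_id_id]
  · intro μ
    have h1 : P.at' μ * T = S⁻¹ * (C μ).submatrix e f := by
      rw [← h μ, ← Matrix.mul_assoc, ← Matrix.mul_assoc, nonsing_inv_mul _ hSd, Matrix.one_mul]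
    rw [← Matrix.mul_assoc, h1, Matrix.mul_assoc, submatrix_mul_equiv, hC, Matrix.mul_assoc]
    rfl

theorem IsKCF.hasRightBlocks (hK : P.IsKCF K) : P.HasRightBlocks K.rightIndex := by
  obtain ⟨e, f, S, T, hS, hT, h⟩ := StrictEquiv.at'_eq hK
  refine hasRightBlocks_of_strictEquiv hS hT h (fromRows 0 (fromRows 1 0))
    (fromRows 0 (fromRows 1 0)) ?_ fun μ => ?_
  · simp [transpose_fromRows, fromCols_mul_fromRows]
  · rw [at'_directSum, K.at'_singularPart]
    simp [fromBlocks_mul_fromRows, fromRows_mul]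

/-- Transposition exchanges `L_j` with `L_jᵀ`, so everything about left kernels can be read off from
right kernels of the transposed pencil. -/
theorem IsKCF.transpose_hasRightBlocks (hK : P.IsKCF K) :
    P.transpose.HasRightBlocks K.leftIndex := by
  obtain ⟨e, f, S, T, hS, hT, h⟩ := StrictEquiv.at'_eq hK
  have h' : ∀ μ, Tᵀ * P.transpose.at' μ * Sᵀ =
      (((K.regularPart.directSum K.singularPart).at' μ)ᵀ).submatrix f e := by
    intro μ
    rw [at'_transpose, ← transpose_submatrix, ← h μ, transpose_mul, transpose_mul,
      Matrix.mul_assoc]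
  refine hasRightBlocks_of_strictEquiv ((isUnit_transpose _).2 hT) ((isUnit_transpose _).2 hS) h'
    (fromRows 0 (fromRows 0 1)) (fromRows 0 (fromRows 0 1)) ?_ fun μ => ?_
  · simp [transpose_fromRows, fromCols_mul_fromRows]
  · rw [at'_directSum, K.at'_singularPart]
    simp [fromBlocks_transpose, fromBlocks_mul_fromRows, fromRows_mul]

end KCF

end MatPencil

/-! ### Generic sets from complex polynomials -/

section Generic

open MvPolynomial

variable {m n : Type}

theorem MvPolynomial.exists_eval_ofReal_eq {σ : Type} (q : MvPolynomial σ ℂ) :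
    ∃ q₁ q₂ : MvPolynomial σ ℝ, ∀ x : σ → ℝ,
      eval (fun i => (x i : ℂ)) q = (eval x q₁ : ℝ) + (eval x q₂ : ℝ) * Complex.I := by
  induction q using MvPolynomial.induction_on with
  | C a => exact ⟨C a.re, C a.im, fun x => by simp [Complex.re_add_im]⟩
  | add p q hp hq =>
    obtain ⟨p₁, p₂, hp⟩ := hp
    obtain ⟨q₁, q₂, hq⟩ := hq
    refine ⟨p₁ + q₁, p₂ + q₂, fun x => ?_⟩
    simp only [map_add, hp, hq, Complex.ofReal_add]
    ring
  | mul_X p i hp =>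
    obtain ⟨p₁, p₂, hp⟩ := hp
    refine ⟨p₁ * X i, p₂ * X i, fun x => ?_⟩
    simp only [map_mul, hp, eval_X, Complex.ofReal_mul]
    ring

/-- The real and imaginary parts of the entries of a matrix. -/
def reIm (M : Matrix m n ℂ) : (m × n) ⊕ (m × n) → ℝ :=
  Sum.elim (fun ij => (M ij.1 ij.2).re) fun ij => (M ij.1 ij.2).im

/-- Evaluation of a complex polynomial in the real and imaginary parts of the entries. -/
def evalReIm (M : Matrix m n ℂ) : MvPolynomial ((m × n) ⊕ (m × n)) ℂ →+* ℂ :=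
  eval fun p => (reIm M p : ℂ)

/-- At real arguments `q` is `q₁ + i q₂` with real polynomials, so its zeros are their common zeros;
`M₀` shows that this set is proper. -/
theorem isGenericSet_evalReIm_ne_zero (q : MvPolynomial ((m × n) ⊕ (m × n)) ℂ)
    {M₀ : Matrix m n ℂ} (h : evalReIm M₀ q ≠ 0) : IsGenericSet {M | evalReIm M q ≠ 0} := by
  classical
  obtain ⟨q₁, q₂, hq⟩ := q.exists_eval_ofReal_eq
  refine ⟨{q₁, q₂}, ?_, ?_⟩
  · intro hu
    have hM : ∀ p ∈ ({q₁, q₂} : Finset (MvPolynomial _ ℝ)), eval (reIm M₀) p = 0 :=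
      Set.eq_univ_iff_forall.1 hu M₀
    refine h ((hq (reIm M₀)).trans ?_)
    rw [hM q₁ (by simp), hM q₂ (by simp)]
    simp
  · intro M hM
    have hM0 : evalReIm M q = 0 := by simpa using hM
    have h3 := (hq (reIm M)).symm.trans hM0
    have hre := congrArg Complex.re h3
    have him := congrArg Complex.im h3
    simp at hre him
    intro p hp
    rcases Finset.mem_insert.1 hp with rfl | hp
    · exact hre
    · rw [Finset.mem_singleton.1 hp]
      exact him

end Generic

/-! ### Determinants of bounded column degree; resultants and separability -/

namespace Polynomial

variable {R : Type*} [CommRing R]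

theorem natDegree_prod_le_sum {ι : Type*} (s : Finset ι) (f : ι → R[X]) (d : ι → ℕ)
    (h : ∀ i ∈ s, (f i).natDegree ≤ d i) : (∏ i ∈ s, f i).natDegree ≤ ∑ i ∈ s, d i :=
  (natDegree_prod_le _ _).trans (Finset.sum_le_sum h)

theorem coeff_prod_sum {ι : Type*} (s : Finset ι) (f : ι → R[X]) (d : ι → ℕ)
    (h : ∀ i ∈ s, (f i).natDegree ≤ d i) :
    (∏ i ∈ s, f i).coeff (∑ i ∈ s, d i) = ∏ i ∈ s, (f i).coeff (d i) := by
  classical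
  induction s using Finset.induction_on with
  | empty => simp
  | insert a s ha ih =>
    rw [Finset.prod_insert ha, Finset.prod_insert ha, Finset.sum_insert ha,
      coeff_mul_add_eq_of_natDegree_le (h a (Finset.mem_insert_self a s))
        (natDegree_prod_le_sum s f d fun i hi => h i (Finset.mem_insert_of_mem hi)),
      ih fun i hi => h i (Finset.mem_insert_of_mem hi)]

variable {n : Type*} [Fintype n] [DecidableEq n]

theorem natDegree_det_le_sum (N : Matrix n n R[X]) (d : n → ℕ)
    (h : ∀ i j, (N i j).natDegree ≤ d j) : N.det.natDegree ≤ ∑ j, d j := by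
  rw [det_apply']
  refine natDegree_sum_le_of_forall_le _ _ fun σ _ => ?_
  refine natDegree_mul_le.trans ?_
  have h1 : (((Equiv.Perm.sign σ : ℤ) : R[X])).natDegree = 0 := natDegree_intCast _
  rw [h1, zero_add]
  exact natDegree_prod_le_sum _ _ _ fun j _ => h _ _

/-- Every term of the Leibniz expansion has one factor from each column, so its top coefficient is
the product of the columnwise top coefficients. -/
theorem coeff_det_sum (N : Matrix n n R[X]) (d : n → ℕ) (h : ∀ i j, (N i j).natDegree ≤ d j) :
    N.det.coeff (∑ j, d j) = (of fun i j => (N i j).coeff (d j)).det := by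
  rw [det_apply', det_apply', finsetSum_coeff]
  refine Finset.sum_congr rfl fun σ _ => ?_
  rw [coeff_intCast_mul, coeff_prod_sum _ _ _ fun j _ => h _ _]
  rfl

theorem resultant_derivative_ne_zero {K : Type*} [Field K] [CharZero K] {f : K[X]}
    (h : f.Separable) : resultant f (derivative f) f.natDegree (f.natDegree - 1) ≠ 0 := by
  have := resultant_ne_zero f (derivative f) h
  rwa [natDegree_derivative] at this

/-- The resultant is a combination of `f` and its derivative. The formal degree `d` may exceed the
true one, because a specialization of a polynomial family can lose degree. -/
theorem separable_of_resultant_ne_zero {K : Type*} [Field K] {f : K[X]} {d : ℕ}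
    (hd : f.natDegree ≤ d) (hd0 : d ≠ 0) (h : resultant f (derivative f) d (d - 1) ≠ 0) :
    f.Separable := by
  obtain ⟨p, q, -, -, hpq⟩ := exists_mul_add_mul_eq_C_resultant (m := d) (n := d - 1)
    f (derivative f) hd ((natDegree_derivative_le f).trans (Nat.sub_le_sub_right hd 1))
    (Or.inl hd0)
  refine ⟨C (resultant f (derivative f) d (d - 1))⁻¹ * p,
    C (resultant f (derivative f) d (d - 1))⁻¹ * q, ?_⟩
  have h1 : C (resultant f (derivative f) d (d - 1))⁻¹ *
      C (resultant f (derivative f) d (d - 1)) = 1 := by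
    rw [← C_mul, inv_mul_cancel₀ h, C_1]
  linear_combination C (resultant f (derivative f) d (d - 1))⁻¹ * hpq + h1

end Polynomial

/-! ### The polynomial detecting common kernel vectors -/

section KernelPolynomial

open Polynomial MatPencil

variable {R : Type*} [CommRing R] {k : ℕ} (m : Fin k → ℕ)

/-- The polynomial `det (W v(X))`, where `v` is the kernel of `diag (L_{m_1}, …, L_{m_k})`. -/
def kernelPoly (W : Matrix (Fin k) (Σ i, Fin (m i + 1)) R) : R[X] :=
  (of fun l i => ∑ j : Fin (m i + 1), C (W l ⟨i, j⟩) * X ^ (j : ℕ) :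
    Matrix (Fin k) (Fin k) R[X]).det

/-- Allows the entries of `W` to be indeterminates that are specialized later. -/
theorem map_kernelPoly {S : Type*} [CommRing S] (φ : R →+* S)
    (W : Matrix (Fin k) (Σ i, Fin (m i + 1)) R) :
    (kernelPoly m W).map φ = kernelPoly m (W.map φ) := by
  rw [kernelPoly, kernelPoly, ← coe_mapRingHom, RingHom.map_det]
  congr 1
  ext l i : 2
  simp [Polynomial.map_sum]

theorem natDegree_entry_le (W : Matrix (Fin k) (Σ i, Fin (m i + 1)) R) (l i : Fin k) :
    (∑ j : Fin (m i + 1), C (W l ⟨i, j⟩) * X ^ (j : ℕ)).natDegree ≤ m i :=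
  natDegree_sum_le_of_forall_le _ _ fun j _ =>
    (natDegree_C_mul_X_pow_le _ _).trans (Nat.lt_succ_iff.1 j.2)

theorem natDegree_kernelPoly_le (W : Matrix (Fin k) (Σ i, Fin (m i + 1)) R) :
    (kernelPoly m W).natDegree ≤ ∑ i, m i :=
  natDegree_det_le_sum _ _ fun l i => natDegree_entry_le m W l i

theorem mul_kernelMatrix_apply (W : Matrix (Fin k) (Σ i, Fin (m i + 1)) ℂ) (μ : OnePoint ℂ)
    (l i : Fin k) :
    (W * kernelMatrix m μ) l i = ∑ j : Fin (m i + 1), W l ⟨i, j⟩ * rightKernel (m i) μ j := by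
  rw [mul_apply, Fintype.sum_sigma, Finset.sum_eq_single i]
  · simp [kernelMatrix]
  · intro a _ ha
    exact Finset.sum_eq_zero fun j _ => by simp [kernelMatrix, ha]
  · simp

theorem eval_kernelPoly (W : Matrix (Fin k) (Σ i, Fin (m i + 1)) ℂ) (z : ℂ) :
    (kernelPoly m W).eval z = (W * kernelMatrix m (z : OnePoint ℂ)).det := by
  rw [kernelPoly, ← coe_evalRingHom, RingHom.map_det]
  congr 1
  ext l i
  rw [mul_kernelMatrix_apply]
  simp only [RingHom.mapMatrix_apply, map_apply, of_apply, coe_evalRingHom, eval_finsetSum,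
    eval_mul, eval_C, eval_pow, eval_X]
  rfl

/-- The kernel vector at `∞` selects the top power in each column, so full degree means that `∞` is
not a kernel root. -/
theorem coeff_kernelPoly (W : Matrix (Fin k) (Σ i, Fin (m i + 1)) ℂ) :
    (kernelPoly m W).coeff (∑ i, m i) = (W * kernelMatrix m OnePoint.infty).det := by
  rw [kernelPoly, coeff_det_sum (of fun l i => ∑ j : Fin (m i + 1), C (W l ⟨i, j⟩) * X ^ (j : ℕ))
    m fun l i => natDegree_entry_le m W l i]
  congr 1
  ext l i
  rw [mul_kernelMatrix_apply]
  simp only [of_apply, finsetSum_coeff, coeff_C_mul, coeff_X_pow]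
  refine Finset.sum_congr rfl fun j _ => ?_
  congr 1
  change (if m i = j then (1 : ℂ) else 0) = if j = Fin.last (m i) then 1 else 0
  refine if_congr ?_ rfl rfl
  rw [Fin.ext_iff, Fin.val_last, eq_comm]

/-- Every finite set of prescribed distinct roots occurs. -/
theorem exists_kernelPoly_eq_prod (γ : (Σ i, Fin (m i)) → ℂ) :
    ∃ W : Matrix (Fin k) (Σ i, Fin (m i + 1)) ℂ, kernelPoly m W = ∏ p, (X - C (γ p)) := by
  let f : Fin k → ℂ[X] := fun i => ∏ j : Fin (m i), (X - C (γ ⟨i, j⟩))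
  -- Row `l` carries the coefficients of `f l` in its own block, making the matrix under the
  -- determinant diagonal.
  refine ⟨of fun l p => if l = p.1 then (f p.1).coeff p.2 else 0, ?_⟩
  have h : (of fun l i => ∑ j : Fin (m i + 1), C ((of fun l p => if l = p.1 then
      (f p.1).coeff p.2 else 0 : Matrix (Fin k) (Σ i, Fin (m i + 1)) ℂ) l ⟨i, j⟩) * X ^ (j : ℕ) :
      Matrix (Fin k) (Fin k) ℂ[X]) = diagonal f := by
    ext1 l i
    by_cases hl : l = i
    · subst hl
      have hdeg : (f l).natDegree = m l := by
        rw [natDegree_prod_of_monic _ _ fun j _ => monic_X_sub_C _]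
        simp
      rw [diagonal_apply_eq, (f l).as_sum_range_C_mul_X_pow, hdeg,
        Finset.sum_range fun j => C ((f l).coeff j) * X ^ j]
      simp
    · simp [hl]
  rw [kernelPoly, h, det_diagonal, Fintype.prod_sigma]

theorem separable_prod_mul_prod {ι : Type*} [Fintype ι] {γ : ι → ℂ} (hγ : Function.Injective γ)
    (E : Finset ℂ) (hE : ∀ i, γ i ∉ E) :
    ((∏ i, (X - C (γ i))) * ∏ e ∈ E, (X - C e)).Separable := by
  refine Separable.mul (separable_prod_X_sub_C_iff.2 hγ)
    (separable_prod_X_sub_C_iff'.2 fun _ _ _ _ h => h) ?_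
  refine IsCoprime.prod_left fun i _ => IsCoprime.prod_right fun e he => ?_
  refine isCoprime_X_sub_C_of_isUnit_sub (sub_ne_zero.2 ?_).isUnit
  rintro rfl
  exact hE i he

end KernelPolynomial

/-! ### Kernel roots for generic matrices -/

namespace MatPencil

variable {n k : ℕ}

/-- The distinct numbers `α i` are the points where the kernels of `P` and `W` meet, apart from
the eigenvalues of `P`; here `n - k` is the normal rank of `P`. -/
structure IsKernelRoots (P : MatPencil (Fin n) (Fin n)) (W : Matrix (Fin k) (Fin n) ℂ) {M : ℕ}
    (α : Fin M → ℂ) : Prop where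
  injective : Function.Injective α
  exists_vec : ∀ i, ∃ x, x ≠ 0 ∧ P.at' (α i) *ᵥ x = 0 ∧ W *ᵥ x = 0
  eq_zero : ∀ μ : OnePoint ℂ, (P.at' μ).rank + k = n → (∀ i, μ ≠ α i) →
    ∀ x, P.at' μ *ᵥ x = 0 → W *ᵥ x = 0 → x = 0

/-- `T v(μ)` is injective with `k` columns and lies in the kernel of `P` at `μ`; if that kernel has
dimension `k`, it is the whole kernel. A common kernel vector with `W` then exists exactly when `W T
v(μ)` is singular. -/
theorem isKernelRoots_of_kernelPoly {P : MatPencil (Fin n) (Fin n)} {m : Fin k → ℕ}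
    {T : Matrix (Fin n) (Σ i, Fin (m i + 1)) ℂ} {T' : Matrix (Σ i, Fin (m i + 1)) (Fin n) ℂ}
    {G : Matrix (Fin n) (Σ i, Fin (m i)) ℂ} (hT : T' * T = 1)
    (hG : ∀ μ, P.at' μ * T = G * (rightBlocks m).at' μ) (W : Matrix (Fin k) (Fin n) ℂ)
    (hc : (kernelPoly m (W * T)).coeff (∑ i, m i) ≠ 0) {α : Fin (∑ i, m i) → ℂ}
    (hα : Function.Injective α) (hroot : ∀ z, (kernelPoly m (W * T)).IsRoot z ↔ ∃ i, α i = z) :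
    P.IsKernelRoots W α := by
  have hTinj : ∀ x, T *ᵥ x = 0 → x = 0 := by
    intro x hx
    have h1 := congrArg (T' *ᵥ ·) hx
    simpa [mulVec_mulVec, hT] using h1
  have hker : ∀ μ c, P.at' μ *ᵥ (T *ᵥ (kernelMatrix m μ *ᵥ c)) = 0 := by
    intro μ c
    rw [mulVec_mulVec, hG, ← mulVec_mulVec, rightBlocks_mul_kernelMatrix, mulVec_zero]
  refine ⟨hα, fun i => ?_, fun μ hr hμ x hx hWx => ?_⟩
  · have h1 : (kernelPoly m (W * T)).eval (α i) = 0 := (hroot _).2 ⟨i, rfl⟩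
    rw [eval_kernelPoly] at h1
    obtain ⟨c, hc0, hc1⟩ := exists_mulVec_eq_zero_iff.2 h1
    refine ⟨T *ᵥ (kernelMatrix m (α i : OnePoint ℂ) *ᵥ c),
      fun h => hc0 (kernelMatrix_injective _ _ _ (hTinj _ h)), hker _ _, ?_⟩
    rw [mulVec_mulVec, mulVec_mulVec]
    exact hc1
  · have hdet : (W * T * kernelMatrix m μ).det ≠ 0 := by
      induction μ using OnePoint.rec with
      | infty => rwa [← coeff_kernelPoly]
      | coe z =>
        rw [← eval_kernelPoly]
        intro h
        obtain ⟨i, hi⟩ := (hroot z).1 h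
        exact hμ i (by rw [hi])
    have hle : LinearMap.range (T * kernelMatrix m μ).mulVecLin ≤
        LinearMap.ker (P.at' μ).mulVecLin := by
      rintro _ ⟨c, rfl⟩
      rw [LinearMap.mem_ker, mulVecLin_apply, mulVecLin_apply, ← mulVec_mulVec, hker]
    have hrank : (T * kernelMatrix m μ).rank = k := by
      rw [rank_eq_card_of_injective, Fintype.card_fin]
      intro c hc
      rw [← mulVec_mulVec] at hc
      exact kernelMatrix_injective _ _ _ (hTinj _ hc)
    have h2 := rank_add_finrank_ker (P.at' μ)
    rw [Fintype.card_fin] at h2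
    have heq := Submodule.eq_of_le_of_finrank_le hle (by
      change _ ≤ (T * kernelMatrix m μ).rank
      omega)
    have hmem : x ∈ LinearMap.range (T * kernelMatrix m μ).mulVecLin := by
      rw [heq]
      simpa using hx
    obtain ⟨c, rfl⟩ := hmem
    rw [mulVecLin_apply] at hWx ⊢
    rw [mulVec_mulVec, ← Matrix.mul_assoc] at hWx
    have hc0 : c = 0 := by
      by_contra hc0
      exact hdet (exists_mulVec_eq_zero_iff.1 ⟨c, hc0, hWx⟩)
    rw [hc0, mulVec_zero]

/-- One polynomial condition `q ≠ 0` encodes full degree, simple roots and avoidance of `E`: it is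
the top coefficient times the resultant of `H` and its derivative, where `H` is the kernel
polynomial times `∏ (X - e)`. The matrix `Wpoly` of polynomials in real and imaginary parts covers
both `Uᵀ` and `V*`. -/
theorem exists_isGenericSet_isKernelRoots {P : MatPencil (Fin n) (Fin n)} {m : Fin k → ℕ}
    (hP : P.HasRightBlocks m)
    (Wpoly : Matrix (Fin k) (Fin n) (MvPolynomial ((Fin n × Fin k) ⊕ (Fin n × Fin k)) ℂ))
    (hsurj : ∀ W : Matrix (Fin k) (Fin n) ℂ, ∃ V : Matrix (Fin n) (Fin k) ℂ,
      Wpoly.map (evalReIm V) = W) (E : Finset ℂ) :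
    ∃ Ω : Set (Matrix (Fin n) (Fin k) ℂ), IsGenericSet Ω ∧ ∀ V ∈ Ω,
      ∃ α : Fin (∑ i, m i) → ℂ, (∀ i, α i ∉ E) ∧ P.IsKernelRoots (Wpoly.map (evalReIm V)) α := by
  classical
  obtain ⟨T, T', G, hT, hG⟩ := hP
  -- The extra point keeps the formal degree `L` positive even when all `m i` vanish and `E` is
  -- empty.
  let E₀ : Finset ℂ := insert 0 E
  let hE : Polynomial ℂ := ∏ e ∈ E₀, (Polynomial.X - Polynomial.C e)
  have hEdeg : hE.natDegree = E₀.card := by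
    rw [Polynomial.natDegree_prod_of_monic _ _ fun e _ => Polynomial.monic_X_sub_C e]
    simp
  have hE0 : E₀.card ≠ 0 := Finset.card_ne_zero.2 ⟨0, Finset.mem_insert_self 0 E⟩
  let L := (∑ i, m i) + E₀.card
  have hL0 : L ≠ 0 := by omega
  let Tpoly : Matrix (Fin n) (Σ i, Fin (m i + 1))
    (MvPolynomial ((Fin n × Fin k) ⊕ (Fin n × Fin k)) ℂ) := T.map MvPolynomial.C
  let F := kernelPoly m (Wpoly * Tpoly)
  let H := F * hE.map MvPolynomial.C
  let q := F.coeff (∑ i, m i) * Polynomial.resultant H (Polynomial.derivative H) L (L - 1)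
  have hFmap : ∀ V, F.map (evalReIm V) = kernelPoly m (Wpoly.map (evalReIm V) * T) := by
    intro V
    rw [map_kernelPoly, Matrix.map_mul]
    congr 2
    ext i j
    simp [evalReIm, Tpoly]
  have hHmap : ∀ V, H.map (evalReIm V) = kernelPoly m (Wpoly.map (evalReIm V) * T) * hE := by
    intro V
    rw [Polynomial.map_mul, hFmap, Polynomial.map_map]
    have hid : (evalReIm V).comp MvPolynomial.C = RingHom.id ℂ :=
      RingHom.ext fun z => by simp [evalReIm]
    rw [hid, Polynomial.map_id]
  have hq : ∀ V, evalReIm V q = (kernelPoly m (Wpoly.map (evalReIm V) * T)).coeff (∑ i, m i) *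
      Polynomial.resultant (kernelPoly m (Wpoly.map (evalReIm V) * T) * hE)
        (Polynomial.derivative (kernelPoly m (Wpoly.map (evalReIm V) * T) * hE)) L (L - 1) := by
    intro V
    rw [map_mul, ← Polynomial.coeff_map, hFmap, ← Polynomial.resultant_map_map,
      ← Polynomial.derivative_map, hHmap]
  refine ⟨{V | evalReIm V q ≠ 0}, ?_, fun V hV => ?_⟩
  · have hinf : Infinite {z : ℂ // z ∉ E₀} := E₀.finite_toSet.infinite_compl.to_subtype
    let γ : (Σ i, Fin (m i)) → ℂ := fun p =>
      (Infinite.natEmbedding {z : ℂ // z ∉ E₀} (Fintype.equivFin _ p : ℕ)).1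
    have hγ : Function.Injective γ := fun p p' h => (Fintype.equivFin _).injective
      (Fin.val_injective ((Infinite.natEmbedding _).injective (Subtype.ext h)))
    have hγE : ∀ p, γ p ∉ E₀ := fun p => (Infinite.natEmbedding {z : ℂ // z ∉ E₀} _).2
    obtain ⟨W, hW⟩ := exists_kernelPoly_eq_prod m γ
    -- As `T' T = 1`, this `V` realizes the prescribed kernel polynomial, proving that `q` is not
    -- identically zero.
    obtain ⟨V, hV⟩ := hsurj (W * T')
    refine isGenericSet_evalReIm_ne_zero q (M₀ := V) ?_
    have hWT : Wpoly.map (evalReIm V) * T = W := by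
      rw [hV, Matrix.mul_assoc, hT, Matrix.mul_one]
    have hmonic : (∏ p, (Polynomial.X - Polynomial.C (γ p))).Monic :=
      Polynomial.monic_prod_of_monic _ _ fun p _ => Polynomial.monic_X_sub_C _
    have hdeg : (∏ p, (Polynomial.X - Polynomial.C (γ p))).natDegree = ∑ i, m i := by
      rw [Polynomial.natDegree_prod_of_monic _ _ fun p _ => Polynomial.monic_X_sub_C _]
      simp
    have hdegL : ((∏ p, (Polynomial.X - Polynomial.C (γ p))) * hE).natDegree = L := by
      rw [Polynomial.Monic.natDegree_mul hmonic
        (Polynomial.monic_prod_of_monic _ _ fun p _ => Polynomial.monic_X_sub_C _), hdeg, hEdeg]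
    rw [hq, hWT, hW]
    refine mul_ne_zero ?_ ?_
    · rw [← hdeg, hmonic.coeff_natDegree]
      exact one_ne_zero
    · rw [← hdegL]
      exact Polynomial.resultant_derivative_ne_zero (separable_prod_mul_prod hγ E₀ hγE)
  · rw [Set.mem_ofPred_eq, hq] at hV
    set f := kernelPoly m (Wpoly.map (evalReIm V) * T) with hf
    obtain ⟨hc, hres⟩ := mul_ne_zero_iff.1 hV
    have hdeg : f.natDegree = ∑ i, m i :=
      le_antisymm (natDegree_kernelPoly_le _ _) (Polynomial.le_natDegree_of_ne_zero hc)
    have hf0 : f ≠ 0 := fun h => hc (by rw [h, Polynomial.coeff_zero])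
    -- Separability of the product gives simple roots of `f` and coprimality of `f` with `hE`.
    have hsep : (f * hE).Separable := Polynomial.separable_of_resultant_ne_zero (d := L)
      (Polynomial.natDegree_mul_le.trans (by rw [hdeg, hEdeg])) hL0 hres
    have hcard : f.roots.toFinset.card = ∑ i, m i := by
      rw [Multiset.toFinset_card_of_nodup (Polynomial.nodup_roots hsep.of_mul_left), ← hdeg]
      exact (Polynomial.splits_iff_card_roots).1 (IsAlgClosed.splits f)
    let e := f.roots.toFinset.equivFinOfCardEq hcard
    have hmem : ∀ z, z ∈ f.roots.toFinset ↔ f.IsRoot z := fun z => by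
      rw [Multiset.mem_toFinset, Polynomial.mem_roots hf0]
    refine ⟨fun i => (e.symm i).1, fun i hi => ?_, ?_⟩
    · have h1 : f.IsRoot (e.symm i).1 := (hmem _).1 (e.symm i).2
      obtain ⟨a, b, hab⟩ := hsep.isCoprime
      have h2 := congrArg (Polynomial.eval (e.symm i).1) hab
      have h3 : hE.eval (e.symm i).1 = 0 := by
        rw [Polynomial.eval_prod]
        exact Finset.prod_eq_zero (Finset.mem_insert_of_mem hi) (by simp)
      rw [Polynomial.eval_add, Polynomial.eval_mul, Polynomial.eval_mul, h1.eq_zero, h3] at h2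
      simp at h2
    · refine isKernelRoots_of_kernelPoly hT hG _ hc
        (Subtype.val_injective.comp e.symm.injective) fun z => ?_
      rw [← hf, ← hmem]
      constructor
      · intro hz
        exact ⟨e ⟨z, hz⟩, by simp⟩
      · rintro ⟨i, rfl⟩
        exact (e.symm i).2

/-- For generic `U`, the kernels of `P` and `Uᵀ` meet in distinct points. -/
theorem exists_isGenericSet_transpose {P : MatPencil (Fin n) (Fin n)} {m : Fin k → ℕ}
    (hP : P.HasRightBlocks m) (E : Finset ℂ) :
    ∃ Ω : Set (Matrix (Fin n) (Fin k) ℂ), IsGenericSet Ω ∧ ∀ U ∈ Ω,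
      ∃ α : Fin (∑ i, m i) → ℂ, (∀ i, α i ∉ E) ∧ P.IsKernelRoots Uᵀ α := by
  have key : ∀ V : Matrix (Fin n) (Fin k) ℂ, (of fun i j => MvPolynomial.X (Sum.inl (j, i)) +
      MvPolynomial.C Complex.I * MvPolynomial.X (Sum.inr (j, i)) :
      Matrix (Fin k) (Fin n) (MvPolynomial ((Fin n × Fin k) ⊕ (Fin n × Fin k)) ℂ)).map
        (evalReIm V) = Vᵀ := by
    intro V
    ext i j
    simp [evalReIm, reIm, mul_comm Complex.I, Complex.re_add_im]
  obtain ⟨Ω, hΩ, h⟩ := exists_isGenericSet_isKernelRoots hP _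
    (fun W => ⟨Wᵀ, by rw [key, transpose_transpose]⟩) E
  refine ⟨Ω, hΩ, fun U hU => ?_⟩
  rw [← key U]
  exact h U hU

/-- Complex conjugation is polynomial only in real and imaginary parts, hence the real notion of
genericity. -/
theorem exists_isGenericSet_conjTranspose {P : MatPencil (Fin n) (Fin n)} {m : Fin k → ℕ}
    (hP : P.HasRightBlocks m) (E : Finset ℂ) :
    ∃ Ω : Set (Matrix (Fin n) (Fin k) ℂ), IsGenericSet Ω ∧ ∀ V ∈ Ω,
      ∃ α : Fin (∑ i, m i) → ℂ, (∀ i, α i ∉ E) ∧ P.IsKernelRoots Vᴴ α := by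
  have key : ∀ V : Matrix (Fin n) (Fin k) ℂ, (of fun i j => MvPolynomial.X (Sum.inl (j, i)) -
      MvPolynomial.C Complex.I * MvPolynomial.X (Sum.inr (j, i)) :
      Matrix (Fin k) (Fin n) (MvPolynomial ((Fin n × Fin k) ⊕ (Fin n × Fin k)) ℂ)).map
        (evalReIm V) = Vᴴ := by
    intro V
    ext i j
    apply Complex.ext <;> simp [evalReIm, reIm]
  obtain ⟨Ω, hΩ, h⟩ := exists_isGenericSet_isKernelRoots hP _
    (fun W => ⟨Wᴴ, by rw [key, conjTranspose_conjTranspose]⟩) E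
  refine ⟨Ω, hΩ, fun V hV => ?_⟩
  rw [← key V]
  exact h V hV

end MatPencil

/-! ### Kernels of low-rank updates -/

namespace Matrix

theorem rank_add_le_add {m n : Type*} [Finite m] [Fintype n] (A B : Matrix m n ℂ) :
    (A + B).rank ≤ A.rank + B.rank := by
  rw [Matrix.rank, Matrix.rank, Matrix.rank, mulVecLin_add]
  exact (Submodule.finrank_mono (LinearMap.range_add_le _ _)).trans
    (Submodule.finrank_add_le_finrank_add_finrank _ _)

variable {n κ : Type*} [Fintype n] [Fintype κ]

/-- The common kernel of `A` and `W` lies in that of `A + F W`. Stacking `A` over `W` gives rank at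
most `rank A + card κ`, so the hypothesis makes the two kernels equal. -/
theorem mulVec_eq_zero_of_rank_add_le {A : Matrix n n ℂ} {F : Matrix n κ ℂ} {W : Matrix κ n ℂ}
    (h : A.rank + Fintype.card κ ≤ (A + F * W).rank) {x : n → ℂ} (hx : (A + F * W) *ᵥ x = 0) :
    W *ᵥ x = 0 := by
  have h1 : (fromRows A W).rank ≤ A.rank + Fintype.card κ := by
    have h2 : fromRows A W = fromRows A 0 + fromRows (0 : Matrix n n ℂ) W := by
      ext (i | i) j <;> simp
    rw [h2]
    refine (rank_add_le_add _ _).trans (add_le_add ?_ ?_)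
    · refine rank_le_of_ker_le fun x hx => ?_
      rw [fromRows_mulVec, hx, zero_mulVec]
      ext (i | i) <;> rfl
    · refine (rank_le_of_ker_le (N := W) fun x hx => ?_).trans (rank_le_card_height _)
      rw [fromRows_mulVec, hx, zero_mulVec]
      ext (i | i) <;> rfl
  have h3 : fromRows A W *ᵥ x = 0 := by
    refine ker_eq_of_rank_le (M := A + F * W) (fun x hx => ?_) (h1.trans h) hx
    rw [fromRows_mulVec] at hx
    have h4 : A *ᵥ x = 0 := funext fun i => congrFun hx (Sum.inl i)
    have h5 : W *ᵥ x = 0 := funext fun i => congrFun hx (Sum.inr i)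
    rw [add_mulVec, h4, ← mulVec_mulVec, h5, mulVec_zero, add_zero]
  rw [fromRows_mulVec] at h3
  exact funext fun i => congrFun h3 (Sum.inr i)

/-- If no row vector annihilates both `A` and `U`, and their ranks add up at most to the number of
rows, then the ranges of `A` and `U` are independent. -/
theorem eq_zero_of_mulVec_add_eq_zero {A : Matrix n n ℂ} {U : Matrix n κ ℂ}
    (h : ∀ w, Aᵀ *ᵥ w = 0 → Uᵀ *ᵥ w = 0 → w = 0) (hr : A.rank + Fintype.card κ ≤ Fintype.card n)
    {x : n → ℂ} {c : κ → ℂ} (hx : A *ᵥ x + U *ᵥ c = 0) : A *ᵥ x = 0 ∧ c = 0 := by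
  classical
  have h1 : (fromCols A U).rank = Fintype.card n := by
    rw [← rank_transpose, transpose_fromCols]
    refine rank_eq_card_of_injective fun w hw => ?_
    rw [fromRows_mulVec] at hw
    exact h w (funext fun i => congrFun hw (Sum.inl i)) (funext fun i => congrFun hw (Sum.inr i))
  -- The kernel of `diag (A, 1)` lies in that of `[A U]`; the latter matrix has full row rank, so
  -- the rank bound forces equality.
  have h2 : fromBlocks A 0 0 (1 : Matrix κ κ ℂ) *ᵥ Sum.elim x c = 0 := by
    refine ker_eq_of_rank_le (M := fromCols A U) (fun v hv => ?_) ?_ ?_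
    · rw [fromBlocks_mulVec] at hv
      have h4 : A *ᵥ (v ∘ Sum.inl) = 0 := by
        ext i
        simpa using congrFun hv (Sum.inl i)
      have h5 : v ∘ Sum.inr = 0 := by
        ext i
        simpa using congrFun hv (Sum.inr i)
      rw [fromCols_mulVec, h4, h5, mulVec_zero, add_zero]
    · rw [rank_fromBlocks_diag, rank_one, h1]
      exact hr
    · rw [fromCols_mulVec]
      simpa using hx
  rw [fromBlocks_mulVec] at h2
  constructor
  · ext i
    simpa using congrFun h2 (Sum.inl i)
  · ext i
    simpa using congrFun h2 (Sum.inr i)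

theorem exists_smul_eq_of_card_le_rank_add_one {A : Matrix n n ℂ}
    (h : Fintype.card n ≤ A.rank + 1) {x₀ x : n → ℂ} (h0 : x₀ ≠ 0) (hx₀ : A *ᵥ x₀ = 0)
    (hx : A *ᵥ x = 0) : ∃ c : ℂ, c • x₀ = x := by
  have h1 := rank_add_finrank_ker A
  have m0 : x₀ ∈ LinearMap.ker A.mulVecLin := by simpa using hx₀
  have m1 : x ∈ LinearMap.ker A.mulVecLin := by simpa using hx
  have h2 : (ℂ ∙ x₀) = LinearMap.ker A.mulVecLin := by
    refine Submodule.eq_of_le_of_finrank_le ((Submodule.span_singleton_le_iff_mem _ _).2 m0) ?_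
    rw [finrank_span_singleton h0]
    omega
  rw [← h2] at m1
  exact Submodule.mem_span_singleton.1 m1

theorem transpose_mulVec_star {m p : Type*} [Fintype m] (U : Matrix m p ℂ) (y : m → ℂ) :
    Uᵀ *ᵥ star y = star (Uᴴ *ᵥ y) := by
  rw [star_mulVec, conjTranspose_conjTranspose, mulVec_transpose]

theorem transpose_mulVec_star_eq_zero_iff {m p : Type*} [Fintype m] (U : Matrix m p ℂ)
    (y : m → ℂ) : Uᵀ *ᵥ star y = 0 ↔ Uᴴ *ᵥ y = 0 := by
  rw [transpose_mulVec_star, star_eq_zero]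

end Matrix

/-! ### The random part and the splitting of the perturbed pencil -/

namespace MatPencil

section SimpleDiag

variable {s : ℕ} (γ : Fin s → ℂ)

/-- The pencil `diag (γ_1 - λ, …, γ_s - λ)`. -/
def ofEigenvalues : MatPencil (Fin s) (Fin s) := diag γ fun _ => 1

theorem isRegular_ofEigenvalues : (ofEigenvalues γ).IsRegular := by
  rw [ofEigenvalues, isRegular_diag_iff]
  obtain ⟨z, hz⟩ := (Set.finite_range γ).infinite_compl.nonempty
  exact ⟨z, fun i => by simpa using sub_ne_zero.2 fun h => hz ⟨i, h⟩⟩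

theorem isEigenvalue_ofEigenvalues_iff (μ : OnePoint ℂ) :
    (ofEigenvalues γ).IsEigenvalue μ ↔ ∃ i, μ = γ i := by
  rw [(isRegular_ofEigenvalues γ).isEigenvalue_iff, ofEigenvalues, at'_diag, det_diagonal,
    Finset.prod_eq_zero_iff]
  induction μ using OnePoint.rec with
  | infty =>
    have hA : coeffA OnePoint.infty = 0 := rfl
    have hB : coeffB OnePoint.infty = 1 := rfl
    simp [hA, hB]
  | coe z =>
    have hA : coeffA (z : OnePoint ℂ) = 1 := rfl
    have hB : coeffB (z : OnePoint ℂ) = -z := rfl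
    simp only [hA, hB, Finset.mem_univ, true_and, one_mul, mul_one, ← sub_eq_add_neg, sub_eq_zero,
      OnePoint.coe_eq_coe, eq_comm]

theorem le_rank_ofEigenvalues_add_one (hγ : Function.Injective γ) (i : Fin s) :
    s ≤ ((ofEigenvalues γ).at' (γ i : OnePoint ℂ)).rank + 1 := by
  have hA : coeffA (γ i : OnePoint ℂ) = 1 := rfl
  have hB : coeffB (γ i : OnePoint ℂ) = -γ i := rfl
  rw [ofEigenvalues, at'_diag, rank_diagonal, hA, hB]
  have h : Fintype.card {j // 1 * γ j + -γ i * 1 ≠ 0} = Fintype.card {j // ¬ j = i} :=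
    Fintype.card_congr (Equiv.subtypeEquivRight fun j => by
      rw [one_mul, mul_one, ← sub_eq_add_neg, sub_ne_zero, hγ.ne_iff])
  rw [h, Fintype.card_subtype_compl, Fintype.card_subtype_eq, Fintype.card_fin]
  omega

/-- The Kronecker data of a pencil `diag (γ_1 - λ, …, γ_s - λ)`. -/
def kroneckerDataOfEigenvalues : KroneckerData where
  numFin := s
  finEig := γ
  finSize := fun _ => 1
  finSize_pos := fun _ => one_pos
  numInf := 0
  infSize := fun _ => 1
  infSize_pos := fun _ => one_pos
  numRight := 0
  rightIndex := fun _ => 0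
  numLeft := 0
  leftIndex := fun _ => 0

theorem exists_isKCF_ofEigenvalues (hγ : Function.Injective γ) :
    ∃ K : KroneckerData, (ofEigenvalues γ).IsKCF K ∧ K.Simple := by
  refine ⟨kroneckerDataOfEigenvalues γ, ?_, ⟨fun _ => rfl, fun _ => rfl⟩, hγ, Nat.zero_le 1⟩
  have hss : (kroneckerDataOfEigenvalues γ).Semisimple := ⟨fun _ => rfl, fun _ => rfl⟩
  have h0 : IsEmpty (Fin (kroneckerDataOfEigenvalues γ).numInf) := Fin.isEmpty
  have h1 : IsEmpty (Fin (kroneckerDataOfEigenvalues γ).numRight) := Fin.isEmpty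
  have h2 : IsEmpty (Fin (kroneckerDataOfEigenvalues γ).numLeft) := Fin.isEmpty
  let g : Fin s → (kroneckerDataOfEigenvalues γ).RegIdx := fun i =>
    Sum.inl ⟨i, (0 : Fin 1)⟩
  have hg : Function.Injective g := fun i j h => congrArg Sigma.fst (Sum.inl_injective h)
  have hg' : Function.Surjective g := by
    rintro (⟨i, a⟩ | ⟨i, a⟩)
    · refine ⟨i, ?_⟩
      have : a = (0 : Fin 1) := Subsingleton.elim (α := Fin 1) _ _
      subst this
      rfl
    · exact h0.elim i
  let e := (Equiv.ofBijective g ⟨hg, hg'⟩).trans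
    (Equiv.sumEmpty _ (kroneckerDataOfEigenvalues γ).SingRow).symm
  let f := (Equiv.ofBijective g ⟨hg, hg'⟩).trans
    (Equiv.sumEmpty _ (kroneckerDataOfEigenvalues γ).SingCol).symm
  refine ⟨e, f, 1, 1, isUnit_one, isUnit_one, ?_, ?_⟩
  · rw [Matrix.one_mul, Matrix.mul_one, KroneckerData.regularPart_eq_diag _ hss]
    ext i j
    change diagonal γ i j = diagonal _ (g i) (g j)
    by_cases hij : i = j
    · subst hij
      rw [diagonal_apply_eq, diagonal_apply_eq]
      rfl
    · rw [diagonal_apply_ne _ hij, diagonal_apply_ne _ (hg.ne hij)]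
  · rw [Matrix.one_mul, Matrix.mul_one, KroneckerData.regularPart_eq_diag _ hss]
    ext i j
    change diagonal _ i j = diagonal _ (g i) (g j)
    by_cases hij : i = j
    · subst hij
      rw [diagonal_apply_eq, diagonal_apply_eq]
      rfl
    · rw [diagonal_apply_ne _ hij, diagonal_apply_ne _ (hg.ne hij)]

end SimpleDiag

theorem IsRegular.rank_eq_of_not_isEigenvalue {m : Type} [Fintype m] [DecidableEq m]
    {P : MatPencil m m} (h : P.IsRegular) {μ : OnePoint ℂ} (hμ : ¬ P.IsEigenvalue μ) :
    (P.at' μ).rank = Fintype.card m := by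
  rw [h.isEigenvalue_iff] at hμ
  exact rank_of_det_ne_zero hμ

section RankCompletion

variable {n k M N : ℕ}

theorem transpose_at'_perturb {P : MatPencil (Fin n) (Fin n)} {D : MatPencil (Fin k) (Fin k)}
    {U V : Matrix (Fin n) (Fin k) ℂ} {τ : ℂ} (μ : OnePoint ℂ) :
    ((P.perturb D U V τ).at' μ)ᵀ = P.transpose.at' μ + τ • (Vᴴᵀ * (D.at' μ)ᵀ) * Uᵀ := by
  rw [at'_perturb, transpose_add, transpose_smul, transpose_mul, transpose_mul, at'_transpose,
    Matrix.smul_mul, Matrix.mul_assoc]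

theorem at'_perturb_eq_add_mul {P : MatPencil (Fin n) (Fin n)} {D : MatPencil (Fin k) (Fin k)}
    {U V : Matrix (Fin n) (Fin k) ℂ} {τ : ℂ} (μ : OnePoint ℂ) :
    (P.perturb D U V τ).at' μ = P.at' μ + τ • (U * D.at' μ) * Vᴴ := by
  rw [at'_perturb, Matrix.smul_mul]

theorem rank_perturb_le (P : MatPencil (Fin n) (Fin n)) (D : MatPencil (Fin k) (Fin k))
    (U V : Matrix (Fin n) (Fin k) ℂ) (τ : ℂ) (μ : OnePoint ℂ) :
    ((P.perturb D U V τ).at' μ).rank ≤ (P.at' μ).rank + (D.at' μ).rank := by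
  rw [at'_perturb_eq_add_mul, ← Matrix.smul_mul]
  exact (rank_add_le_add _ _).trans (Nat.add_le_add_left
    ((rank_mul_le_left _ _).trans (rank_mul_le_right _ _)) _)

/-- If the kernels of `P` and `V*`, and those of `Pᵀ` and `Uᵀ`, meet in the distinct points `α`
and `β`, away from the eigenvalues of `P` and `D`, then the perturbation splits. -/
theorem isRankCompletion_ofEigenvalues {ρ : Type} [Fintype ρ] [DecidableEq ρ]
    {P : MatPencil (Fin n) (Fin n)} {a b : ρ → ℂ} {c d : Fin k → ℂ}
    (hR : (diag a b).IsRegular) (hD : (diag c d).IsRegular)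
    (hrank : ∀ μ, (P.at' μ).rank = ((diag a b).at' μ).rank + (M + N))
    (hcard : Fintype.card ρ + (M + N) + k = n)
    (hdisj : ∀ μ, (diag c d).IsEigenvalue μ → ¬ (diag a b).IsEigenvalue μ)
    {U V : Matrix (Fin n) (Fin k) ℂ} {α : Fin M → ℂ} {β : Fin N → ℂ}
    (hα : P.IsKernelRoots Vᴴ α) (hβ : P.transpose.IsKernelRoots Uᵀ β)
    (hαβ : ∀ i j, α i ≠ β j)
    (hαe : ∀ i, ¬ (diag a b).IsEigenvalue (α i) ∧ ¬ (diag c d).IsEigenvalue (α i))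
    (hβe : ∀ i, ¬ (diag a b).IsEigenvalue (β i) ∧ ¬ (diag c d).IsEigenvalue (β i))
    {τ : ℂ} (hτ : τ ≠ 0) :
    IsRankCompletion P (diag a b) (diag c d) U V τ
      (ofEigenvalues (Sum.elim α β ∘ finSumFinEquiv.symm)) := by
  set γ := Sum.elim α β ∘ (finSumFinEquiv (m := M) (n := N)).symm with hγdef
  set R := diag a b
  set D := diag c d
  set Q := P.perturb D U V τ with hQdef
  have hγinj : Function.Injective γ :=
    (hα.injective.sumElim hβ.injective hαβ).comp (Equiv.injective _)
  have hRan := isRegular_ofEigenvalues γ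
  have hRanE : ∀ μ, (ofEigenvalues γ).IsEigenvalue μ ↔ (∃ i, μ = α i) ∨ ∃ i, μ = β i := by
    intro μ
    rw [isEigenvalue_ofEigenvalues_iff, ← finSumFinEquiv.exists_congr_right, Sum.exists]
    simp [hγdef]
  have hRanR : ∀ μ, (ofEigenvalues γ).IsEigenvalue μ → ¬ R.IsEigenvalue μ ∧ ¬ D.IsEigenvalue μ := by
    intro μ hμ
    rcases (hRanE μ).1 hμ with ⟨i, rfl⟩ | ⟨i, rfl⟩
    · exact hαe i
    · exact hβe i
  have hrankP : ∀ μ, ¬ R.IsEigenvalue μ → (P.at' μ).rank + k = n := by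
    intro μ hμ
    rw [hrank, hR.rank_eq_of_not_isEigenvalue hμ, hcard]
  have hrankPT : ∀ μ, ¬ R.IsEigenvalue μ → (P.transpose.at' μ).rank + k = n := by
    intro μ hμ
    rw [at'_transpose, rank_transpose, hrankP μ hμ]
  have hker : ∀ μ x, P.at' μ *ᵥ x = 0 → Vᴴ *ᵥ x = 0 → Q.at' μ *ᵥ x = 0 := by
    intro μ x hx hVx
    rw [at'_perturb_eq_add_mul, add_mulVec, hx, ← mulVec_mulVec, hVx, mulVec_zero, add_zero]
  have hker' : ∀ μ x, Q.at' μ *ᵥ x = 0 → Vᴴ *ᵥ x = 0 → P.at' μ *ᵥ x = 0 := by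
    intro μ x hx hVx
    rwa [at'_perturb_eq_add_mul, add_mulVec, ← mulVec_mulVec, hVx, mulVec_zero, add_zero] at hx
  have hkerT : ∀ μ w, P.transpose.at' μ *ᵥ w = 0 → Uᵀ *ᵥ w = 0 → (Q.at' μ)ᵀ *ᵥ w = 0 := by
    intro μ x hx hVx
    rw [transpose_at'_perturb, add_mulVec, hx, ← mulVec_mulVec, hVx, mulVec_zero, add_zero]
  have hkerT' : ∀ μ w, (Q.at' μ)ᵀ *ᵥ w = 0 → Uᵀ *ᵥ w = 0 → P.transpose.at' μ *ᵥ w = 0 := by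
    intro μ x hx hVx
    rwa [transpose_at'_perturb, add_mulVec, ← mulVec_mulVec, hVx, mulVec_zero,
      add_zero] at hx
  -- At a point that is an eigenvalue of none of the three parts, the ranges of `P` and `U` are
  -- independent because their left kernels meet trivially. A kernel vector of `Q` is then killed by
  -- `P` and by `D V*`, hence by `V*`, and so is zero.
  have hQreg : Q.IsRegular := by
    have h0 : R.charpoly * (D.charpoly * (ofEigenvalues γ).charpoly) ≠ 0 :=
      mul_ne_zero (R.isRegular_iff.1 hR) (mul_ne_zero (D.isRegular_iff.1 hD)
        ((ofEigenvalues γ).isRegular_iff.1 hRan))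
    obtain ⟨z, hz⟩ : ∃ z, (R.charpoly * (D.charpoly * (ofEigenvalues γ).charpoly)).eval z ≠ 0 := by
      by_contra hn
      push Not at hn
      exact h0 (Polynomial.funext fun z => by rw [hn z, Polynomial.eval_zero])
    rw [Polynomial.eval_mul, Polynomial.eval_mul, MatPencil.eval_charpoly, MatPencil.eval_charpoly,
      MatPencil.eval_charpoly, mul_ne_zero_iff, mul_ne_zero_iff] at hz
    obtain ⟨hzR, hzD, hzRan⟩ := hz
    rw [ne_eq, ← hR.isEigenvalue_iff] at hzR
    rw [ne_eq, ← hRan.isEigenvalue_iff, hRanE, not_or, not_exists, not_exists] at hzRan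
    refine ⟨z, fun hdet => ?_⟩
    obtain ⟨x, hx0, hx⟩ := exists_mulVec_eq_zero_iff.2 hdet
    rw [← at'_coe, at'_perturb_eq_add_mul, add_mulVec, Matrix.smul_mul, smul_mulVec,
      Matrix.mul_assoc, ← mulVec_mulVec, ← mulVec_smul] at hx
    obtain ⟨hPx, hcx⟩ := eq_zero_of_mulVec_add_eq_zero (fun w hw hUw =>
      hβ.eq_zero z (hrankPT z hzR) hzRan.2 w (by rwa [at'_transpose]) hUw)
      (by rw [Fintype.card_fin, Fintype.card_fin, hrankP z hzR]) hx
    have hDV : D.at' z *ᵥ (Vᴴ *ᵥ x) = 0 := by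
      rw [mulVec_mulVec]
      exact (smul_eq_zero.1 hcx).resolve_left hτ
    have hVx : Vᴴ *ᵥ x = 0 := by
      by_contra hne
      exact hzD (exists_mulVec_eq_zero_iff.1 ⟨_, hne, hDV⟩)
    exact hx0 (hα.eq_zero z (hrankP z hzR) hzRan.1 x hPx hVx)
  have hequiv : Q.StrictEquiv (R.directSum (D.directSum (ofEigenvalues γ))) := by
    have hE : (R.directSum (D.directSum (ofEigenvalues γ))).IsRegular :=
      hR.directSum (hD.directSum hRan)
    have hrE : ∀ μ, (Q.at' μ).rank ≤
        ((R.directSum (D.directSum (ofEigenvalues γ))).at' μ).rank := by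
      intro μ
      rw [rank_directSum, rank_directSum]
      -- At a random eigenvalue `Q` is singular while the diagonal pencil loses only one rank;
      -- elsewhere subadditivity of rank suffices.
      by_cases hμ : (ofEigenvalues γ).IsEigenvalue μ
      · have hdet : (Q.at' μ).det = 0 := by
          rcases (hRanE μ).1 hμ with ⟨i, rfl⟩ | ⟨i, rfl⟩
          · obtain ⟨x, hx0, hx, hVx⟩ := hα.exists_vec i
            exact exists_mulVec_eq_zero_iff.1 ⟨x, hx0, hker _ x hx hVx⟩
          · obtain ⟨w, hw0, hw, hUw⟩ := hβ.exists_vec i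
            rw [← det_transpose]
            exact exists_mulVec_eq_zero_iff.1 ⟨w, hw0, hkerT _ w hw hUw⟩
        have h1 := (rank_lt_card_iff _).2 hdet
        have h2 := hR.rank_eq_of_not_isEigenvalue (hRanR μ hμ).1
        have h3 := hD.rank_eq_of_not_isEigenvalue (hRanR μ hμ).2
        obtain ⟨i, rfl⟩ := (isEigenvalue_ofEigenvalues_iff γ μ).1 hμ
        have h4 := le_rank_ofEigenvalues_add_one γ hγinj i
        rw [Fintype.card_fin] at h1 h3
        omega
      · have h1 : (Q.at' μ).rank ≤ _ := rank_perturb_le P D U V τ μ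
        have h2 := hRan.rank_eq_of_not_isEigenvalue hμ
        rw [Fintype.card_fin] at h2
        have h3 := hrank μ
        omega
    have e : Fin n ≃ ρ ⊕ (Fin k ⊕ Fin (M + N)) := Fintype.equivOfCardEq (by
      simp only [Fintype.card_sum, Fintype.card_fin]
      omega)
    simp only [R, D, ofEigenvalues, directSum_diag] at hE hrE ⊢
    exact hQreg.strictEquiv_diag hE e hrE
  have hrankQ : ∀ μ, (Q.at' μ).rank =
      (R.at' μ).rank + ((D.at' μ).rank + ((ofEigenvalues γ).at' μ).rank) := by
    intro μ
    rw [hequiv.rank_eq, rank_directSum, rank_directSum]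
  -- At a true eigenvalue `D` and the random part have full rank, so the update raises the rank by
  -- the maximal amount `k`.
  have htrue : ∀ μ, R.IsEigenvalue μ → (P.at' μ).rank + k ≤ (Q.at' μ).rank := by
    intro μ hμ
    have h1 := hD.rank_eq_of_not_isEigenvalue fun h => hdisj μ h hμ
    have h2 := hRan.rank_eq_of_not_isEigenvalue fun h => (hRanR μ h).1 hμ
    rw [Fintype.card_fin] at h1 h2
    rw [hrankQ, hrank, h1, h2]
    omega
  have hleft : ∀ {μ y}, Q.IsLeftEigenvector μ y → (Q.at' μ)ᵀ *ᵥ star y = 0 := by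
    intro μ y hy
    rw [mulVec_transpose]
    exact hy.2
  have hgoodR : ∀ μ, ¬ R.IsEigenvalue μ → (∀ i, μ ≠ α i) → ∀ x, Q.IsRightEigenvector μ x →
      Vᴴ *ᵥ x ≠ 0 := fun μ hR hμ x hx hVx =>
    hx.1 (hα.eq_zero μ (hrankP μ hR) hμ x (hker' μ x hx.2 hVx) hVx)
  have hgoodL : ∀ μ, ¬ R.IsEigenvalue μ → (∀ i, μ ≠ β i) → ∀ y, Q.IsLeftEigenvector μ y →
      Uᴴ *ᵥ y ≠ 0 := by
    intro μ hR hμ y hy hUy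
    rw [← transpose_mulVec_star_eq_zero_iff] at hUy
    exact hy.1 (star_eq_zero.1
      (hβ.eq_zero μ (hrankPT μ hR) hμ _ (hkerT' μ _ (hleft hy) hUy) hUy))
  refine
    { strictEquiv := hequiv
      regular := hRan
      true_right := fun μ hμ x hx => ?_
      true_left := fun μ hμ y hy => ?_
      prescribed_right := fun μ hμ => hgoodR μ (hdisj μ hμ) fun i hi => (hαe i).2 (hi ▸ hμ)
      prescribed_left := fun μ hμ => hgoodL μ (hdisj μ hμ) fun i hi => (hβe i).2 (hi ▸ hμ)
      random_simple := exists_isKCF_ofEigenvalues γ hγinj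
      random_distinct := hRanR
      random_vectors := fun μ hμ x hx y hy => ?_ }
  · have h1 := htrue μ hμ
    have h2 : Q.at' μ *ᵥ x = 0 := hx.2
    rw [hQdef, at'_perturb_eq_add_mul] at h1 h2
    exact mulVec_eq_zero_of_rank_add_le (by rwa [Fintype.card_fin]) h2
  · have h1 := htrue μ hμ
    have h2 := hleft hy
    rw [← rank_transpose (P.at' μ), ← at'_transpose, ← rank_transpose (Q.at' μ), hQdef,
      transpose_at'_perturb] at h1
    rw [hQdef, transpose_at'_perturb] at h2
    rw [← transpose_mulVec_star_eq_zero_iff]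
    exact mulVec_eq_zero_of_rank_add_le (by rwa [Fintype.card_fin]) h2
  · have hμR := hRanR μ hμ
    -- Kernels at random eigenvalues are lines, so every eigenvector is a multiple of the one
    -- supplied by the kernel root.
    have hone : Fintype.card (Fin n) ≤ (Q.at' μ).rank + 1 := by
      have h2 := hR.rank_eq_of_not_isEigenvalue hμR.1
      have h3 := hD.rank_eq_of_not_isEigenvalue hμR.2
      obtain ⟨i, rfl⟩ := (isEigenvalue_ofEigenvalues_iff γ μ).1 hμ
      have h4 := le_rank_ofEigenvalues_add_one γ hγinj i
      have h5 := hrankQ (γ i)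
      rw [Fintype.card_fin] at h3 ⊢
      omega
    rcases (hRanE μ).1 hμ with ⟨i, rfl⟩ | ⟨i, rfl⟩
    · refine Or.inl ⟨?_, hgoodL _ hμR.1 (fun j h => hαβ i j (OnePoint.coe_injective h)) y hy⟩
      obtain ⟨x₀, hx0, hx₀, hVx⟩ := hα.exists_vec i
      obtain ⟨t, rfl⟩ := exists_smul_eq_of_card_le_rank_add_one hone hx0 (hker _ _ hx₀ hVx) hx.2
      rw [mulVec_smul, hVx, smul_zero]
    · refine Or.inr ⟨hgoodR _ hμR.1 (fun j h => hαβ j i (OnePoint.coe_injective h).symm) x hx, ?_⟩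
      obtain ⟨w₀, hw0, hw₀, hUw⟩ := hβ.exists_vec i
      rw [← rank_transpose] at hone
      obtain ⟨t, ht⟩ :=
        exists_smul_eq_of_card_le_rank_add_one hone hw0 (hkerT _ _ hw₀ hUw) (hleft hy)
      rw [← transpose_mulVec_star_eq_zero_iff, ← ht, mulVec_smul, hUw, smul_zero]

end RankCompletion

theorem IsKCF.exists_indices {n k : ℕ} {P : MatPencil (Fin n) (Fin n)} {K : KroneckerData}
    (hK : P.IsKCF K) (h : K.numRight = k) :
    ∃ m : Fin k → ℕ, P.HasRightBlocks m ∧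
      Fintype.card (Σ i, Fin (K.rightIndex i)) = ∑ i, m i := by
  subst h
  exact ⟨K.rightIndex, hK.hasRightBlocks, by simp⟩

theorem IsKCF.exists_indices_transpose {n k : ℕ} {P : MatPencil (Fin n) (Fin n)}
    {K : KroneckerData} (hK : P.IsKCF K) (h : K.numLeft = k) :
    ∃ m : Fin k → ℕ, P.transpose.HasRightBlocks m ∧
      Fintype.card (Σ i, Fin (K.leftIndex i)) = ∑ i, m i := by
  subst h
  exact ⟨K.leftIndex, hK.transpose_hasRightBlocks, by simp⟩

end MatPencil

end

/-! ### The proposition -/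

theorem proposition4p1 {n k : ℕ} (P : MatPencil (Fin n) (Fin n))
    (hsing : ¬ P.IsRegular) (hrank : P.nrank + k = n)
    (K : KroneckerData) (hK : P.IsKCF K) (hss : K.Semisimple)
    (D : MatPencil (Fin k) (Fin k)) (hDA : D.A.IsDiag) (hDB : D.B.IsDiag) (hD : D.IsRegular)
    (hdisj : ∀ μ : OnePoint ℂ, D.IsEigenvalue μ → ¬ P.IsEigenvalue μ) :
    -- generic `U` and `V` are admissible, with a random part that is independent of `τ`
    (∃ Ω₂ : Set (Matrix (Fin n) (Fin k) ℂ), IsGenericSet Ω₂ ∧ ∀ U ∈ Ω₂,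
      ∃ Ω₃ : Set (Matrix (Fin n) (Fin k) ℂ), IsGenericSet Ω₃ ∧ ∀ V ∈ Ω₃,
        ∃ (s : ℕ) (Ran : MatPencil (Fin s) (Fin s)), ∀ τ : ℂ, τ ≠ 0 →
          IsRankCompletion P K.regularPart D U V τ Ran) ∧
    -- for all admissible `U` and `V`: the eigenvalues of the projected pencil, if it is regular
    (∀ (U V : Matrix (Fin n) (Fin k) ℂ) (τ : ℂ) (s : ℕ) (Ran : MatPencil (Fin s) (Fin s)),
      τ ≠ 0 → IsRankCompletion P K.regularPart D U V τ Ran →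
      ∀ Uperp Vperp : Matrix (Fin n) (Fin (n - k)) ℂ,
        IsOrthComplBasis U Uperp → IsOrthComplBasis V Vperp →
        (P.compress Uperp Vperp).IsRegular →
          (∀ μ : OnePoint ℂ, (P.compress Uperp Vperp).IsEigenvalue μ ↔
            (Ran.IsEigenvalue μ ∨ P.IsEigenvalue μ)) ∧
          (P.compress Uperp Vperp).eigs = Ran.eigs + K.regularPart.eigs) := by

  obtain ⟨hright, hleft⟩ := hK.num_eq hss hrank
  have hR := K.isRegular_regularPart hss
  refine ⟨?_, ?_⟩
  · obtain ⟨m₁, hm₁, hs₁⟩ := hK.exists_indices hright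
    obtain ⟨m₂, hm₂, hs₂⟩ := hK.exists_indices_transpose hleft
    have hrankP := fun μ => hK.rank_eq μ
    have hcard := hK.nrank_eq hss
    have hdisj' : ∀ μ, D.IsEigenvalue μ → ¬ K.regularPart.IsEigenvalue μ := fun μ hμ h =>
      hdisj μ hμ ((hK.isEigenvalue_iff hss μ).2 h)
    have hDeq : D = MatPencil.diag D.A.diag D.B.diag := by
      cases D
      exact congrArg₂ MatPencil.mk hDA.diagonal_diag.symm hDB.diagonal_diag.symm
    -- The finite true and prescribed eigenvalues, to be avoided by `α` and `β`; these are finite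
    -- points, so `∞` needs no care.
    let E : Finset ℂ := (K.regularPart.charpoly * D.charpoly).roots.toFinset
    have hE : ∀ z : ℂ, z ∉ E → ¬ K.regularPart.IsEigenvalue z ∧ ¬ D.IsEigenvalue z := by
      intro z hz
      rw [Multiset.mem_toFinset, Polynomial.mem_roots
        (mul_ne_zero ((MatPencil.isRegular_iff _).1 hR) ((MatPencil.isRegular_iff _).1 hD)),
        Polynomial.IsRoot, Polynomial.eval_mul, mul_eq_zero, not_or, MatPencil.eval_charpoly,
        MatPencil.eval_charpoly] at hz
      rwa [hR.isEigenvalue_iff, hD.isEigenvalue_iff]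
    rw [hs₁, hs₂] at hcard
    simp only [hs₁, hs₂] at hrankP
    rw [K.regularPart_eq_diag hss] at hR hrankP hdisj' hE ⊢
    generalize D.A.diag = c at hDeq
    generalize D.B.diag = d at hDeq
    obtain ⟨Ω₂, hΩ₂, hU⟩ := MatPencil.exists_isGenericSet_transpose hm₂ E
    refine ⟨Ω₂, hΩ₂, fun U hUΩ => ?_⟩
    obtain ⟨β, hβE, hβ⟩ := hU U hUΩ
    obtain ⟨Ω₃, hΩ₃, hV⟩ :=
      -- Also avoiding `β` makes all random eigenvalues distinct; this is why the second generic set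
      -- depends on `U`.
      MatPencil.exists_isGenericSet_conjTranspose hm₁ (E ∪ Finset.univ.image β)
    refine ⟨Ω₃, hΩ₃, fun V hVΩ => ?_⟩
    obtain ⟨α, hαE, hα⟩ := hV V hVΩ
    refine ⟨_, MatPencil.ofEigenvalues (Sum.elim α β ∘ finSumFinEquiv.symm), fun τ hτ => ?_⟩
    rw [hDeq] at hD hdisj' hE ⊢
    refine MatPencil.isRankCompletion_ofEigenvalues hR hD hrankP (by omega) hdisj' hα hβ
      (fun i j h => hαE i (Finset.mem_union_right _
        (Finset.mem_image.2 ⟨j, Finset.mem_univ j, h.symm⟩)))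
      (fun i => hE _ fun h => hαE i (Finset.mem_union_left _ h)) (fun i => hE _ (hβE i)) hτ
  · intro U V τ s Ran hτ hc W Z hU hV hreg
    have heigs := eigs_compress_eq (show k ≤ n by omega) (show P.nrank ≤ n - k by omega) hD hR
      hc.regular hτ hc.strictEquiv hU hV hreg
    refine ⟨fun μ => ?_, heigs⟩
    rw [hK.isEigenvalue_iff hss, ← hreg.mem_eigs_iff, ← hR.mem_eigs_iff, ← hc.regular.mem_eigs_iff,
      heigs, Multiset.mem_add]
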